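/- Let $\Lambda$ be the ring of symmetric functions over $\mathbb{Q}$ in infinitely many variables, with monomial, elementary, complete homogeneous and power sum symmetric functions $m_\lambda, e_\lambda, h_\lambda, p_\lambda$; let $\omega$ be the standard involution ($\omega(h_\lambda)=e_\lambda$), let $z_\nu=\prod_{i\ge1} i^{m_i}m_i!$ where $m_i$ is the multiplicity of $i$ in the partition $\nu$, and let $[m_\mu]f$ denote the coefficient of $m_\mu$ in the monomial expansion of $f\in\Lambda$. For an integer $k\ge 1$ let $\rho_k:\Lambda\to\Lambda$ be the linear map with $\rho_k(m_{\mu})=m_{\mu/k}$ if all parts of $\mu$ are divisible by $k$, and $\rho_k(m_\mu)=0$ otherwise. For $r\ge1$ set $$\Phi_{k,r}:=-r\,[t^r]\log\Big(\sum_{m\ge0}(-1)^m e_{km}\,t^m\Big),\qquad f_{k,r}:=\sum_{j=1}^{r}(-1)^{r+j}\,\frac rj\sum_{\alpha}e_{k\alpha_1}\cdots e_{k\alpha_j},$$ where the inner sum is over the compositions $\alpha=(\alpha_1,\dots,\alpha_j)$ of $r$ into $j$ positive parts. Corollary. Let $k\ge1$. (1) $\Phi_{k,r}=f_{k,r}$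 for all $r\ge 1$. (2) For every partition $\mu$, the symmetric function $\omega(\rho_k(e_\mu))$ is $p$-positive, in the sense that it is a finite linear combination of the functions $p_\nu/z_\nu$ with nonnegative integer coefficients (so its coefficients in the basis $p_\nu$ are nonnegative rational numbers). (3) More precisely, if $\mu\vdash nk$ with $n\ge0$, then there is exactly one family of rational numbers $(a^{(k)}_{\mu,\nu})_{\nu\vdash n}$ with $$\omega(\rho_k(e_\mu))=\sum_{\nu\vdash n}\frac{a^{(k)}_{\mu,\nu}}{z_\nu}\,p_\nu ,$$ namely $a^{(k)}_{\mu,\nu}=[m_\mu]\prod_{j=1}^{\ell(\nu)}\Phi_{k,\nu_j}$, and all these numbers are nonnegative integers. -/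

import Mathlib

noncomputable section

namespace SymFn

/-- The ring `Λ` of symmetric functions over `ℚ` in the variables `x₀, x₁, x₂, …`: the formal power
series of bounded degree that are invariant under all permutations of the variables. -/
def symSubalgebra : Subalgebra ℚ (MvPowerSeries ℕ ℚ) where
  carrier := {f | (∀ σ : Equiv.Perm ℕ, MvPowerSeries.rename σ f = f) ∧
    ∃ N : ℕ, ∀ d : ℕ →₀ ℕ, N < d.degree → MvPowerSeries.coeff d f = 0}
  mul_mem' := by
    rintro f g ⟨hf, N, hN⟩ ⟨hg, M, hM⟩
    refine ⟨fun σ => by rw [map_mul, hf, hg], N + M, fun d hd => ?_⟩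
    classical
    rw [MvPowerSeries.coeff_mul]
    refine Finset.sum_eq_zero fun p hp => ?_
    have hp' : p.1 + p.2 = d := by simpa using hp
    have h3 : p.1.degree + p.2.degree = d.degree := by rw [← hp', map_add]
    rcases lt_or_ge N p.1.degree with h | h
    · rw [hN _ h, zero_mul]
    · rw [hM _ (by omega), mul_zero]
  add_mem' := by
    rintro f g ⟨hf, N, hN⟩ ⟨hg, M, hM⟩
    refine ⟨fun σ => by rw [map_add, hf, hg], N + M, fun d hd => ?_⟩
    rw [map_add, hN _ (by omega), hM _ (by omega), add_zero]
  algebraMap_mem' := by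
    intro r
    refine ⟨fun σ => AlgHom.commutes _ r, 0, fun d hd => ?_⟩
    classical
    rw [MvPowerSeries.algebraMap_apply, MvPowerSeries.coeff_C, if_neg]
    rintro rfl
    simp at hd

/-- The type of symmetric functions over `ℚ`. -/
def Sym : Type := symSubalgebra

instance : CommRing Sym := inferInstanceAs (CommRing symSubalgebra)

instance : Algebra ℚ Sym := inferInstanceAs (Algebra ℚ symSubalgebra)

/-- The inclusion of the symmetric functions in the formal power series. -/
def toSeries : Sym →ₐ[ℚ] MvPowerSeries ℕ ℚ := symSubalgebra.val

/-- The coefficient of the monomial `x ^ d` in a symmetric function. -/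
def coeff (d : ℕ →₀ ℕ) : Sym →ₗ[ℚ] ℚ := (MvPowerSeries.coeff d).comp toSeries.toLinearMap

theorem rename_eq_iff (f : MvPowerSeries ℕ ℚ) (σ : Equiv.Perm ℕ) :
    MvPowerSeries.rename σ f = f ↔
      ∀ d : ℕ →₀ ℕ, MvPowerSeries.coeff (d.mapDomain σ) f = MvPowerSeries.coeff d f := by
  have key : ∀ d : ℕ →₀ ℕ, MvPowerSeries.coeff (d.mapDomain σ) (MvPowerSeries.rename σ f)
      = MvPowerSeries.coeff d f := by
    intro d
    have := MvPowerSeries.coeff_embDomain_rename σ.toEmbedding f d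
    rw [Finsupp.embDomain_eq_mapDomain] at this
    exact this
  constructor
  · intro h d
    have := key d
    rwa [h] at this
  · intro h
    ext d
    obtain ⟨d', rfl⟩ : ∃ d' : ℕ →₀ ℕ, d'.mapDomain σ = d :=
      ⟨d.mapDomain σ.symm, by rw [← Finsupp.mapDomain_comp]; simp⟩
    rw [key, h]

@[ext]
theorem ext {f g : Sym} (h : ∀ d, coeff d f = coeff d g) : f = g :=
  Subtype.ext (MvPowerSeries.ext h)

theorem coeff_mapDomain (f : Sym) (σ : Equiv.Perm ℕ) (d : ℕ →₀ ℕ) :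
    coeff (d.mapDomain σ) f = coeff d f :=
  (rename_eq_iff _ σ).1 (f.2.1 σ) d

/-- The symmetric function with a given family of coefficients. -/
def ofCoeff (c : (ℕ →₀ ℕ) → ℚ) (hc : ∀ (σ : Equiv.Perm ℕ) d, c (d.mapDomain σ) = c d)
    (hN : ∃ N : ℕ, ∀ d : ℕ →₀ ℕ, N < d.degree → c d = 0) : Sym :=
  ⟨c, fun σ => (rename_eq_iff _ σ).2 (hc σ), hN⟩

@[simp]
theorem coeff_ofCoeff (c : (ℕ →₀ ℕ) → ℚ) (hc hN) (d) : coeff d (ofCoeff c hc hN) = c d := rfl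

/-- The multiset of nonzero exponents of an exponent vector. -/
def vals {ι : Type} (d : ι →₀ ℕ) : Multiset ℕ := d.support.val.map d

theorem vals_embDomain {ι κ : Type} (f : ι ↪ κ) (d : ι →₀ ℕ) :
    vals (d.embDomain f) = vals d := by
  rw [vals, Finsupp.support_embDomain, Finset.map_val, Multiset.map_map, vals]
  exact Multiset.map_congr rfl fun x _ => Finsupp.embDomain_apply_self _ _ _

theorem vals_mapDomain {ι : Type} (σ : Equiv.Perm ι) (d : ι →₀ ℕ) :
    vals (d.mapDomain σ) = vals d := by
  have h := vals_embDomain σ.toEmbedding d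
  rw [Finsupp.embDomain_eq_mapDomain] at h
  exact h

theorem degree_eq_sum_vals {ι : Type} (d : ι →₀ ℕ) : d.degree = (vals d).sum := rfl

/-- The monomial symmetric function `m_s`, the sum of all distinct monomials whose multiset of
nonzero exponents is `s`. -/
def m (s : Multiset ℕ) : Sym :=
  ofCoeff (fun d => if vals d = s then 1 else 0) (fun σ d => by simp only [vals_mapDomain])
    ⟨s.sum, fun d hd => if_neg (by rintro rfl; exact lt_irrefl _ hd)⟩

/-- The elementary symmetric function `e_n`, the sum of all squarefree monomials of degree `n`. -/
def e (n : ℕ) : Sym :=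
  open Classical in
  ofCoeff (fun d => if (∀ i, d i ≤ 1) ∧ d.degree = n then 1 else 0)
    (fun σ d => by
      have : (∀ i, d.mapDomain σ i ≤ 1) ↔ ∀ i, d i ≤ 1 := by
        rw [← σ.forall_congr_right]
        simp only [Finsupp.mapDomain_apply σ.injective]
      have this' := and_congr this
        (show (d.mapDomain σ).degree = n ↔ d.degree = n by rw [Finsupp.degree_mapDomain])
      by_cases hc : (∀ i, d i ≤ 1) ∧ d.degree = n
      · rw [if_pos hc, if_pos (this'.2 hc)]
      · rw [if_neg hc, if_neg (mt this'.1 hc)])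
    ⟨n, fun d hd => if_neg fun h => by omega⟩

/-- The complete homogeneous symmetric function `h_n`, the sum of all monomials of degree `n`. -/
def h (n : ℕ) : Sym :=
  ofCoeff (fun d => if d.degree = n then 1 else 0)
    (fun σ d => by simp only [Finsupp.degree_mapDomain])
    ⟨n, fun d hd => if_neg fun h => by omega⟩

/-- The power sum symmetric function `p_r = ∑ i, x_i ^ r` (for `r ≥ 1`). -/
def p (r : ℕ) : Sym :=
  open Classical in
  ofCoeff (fun d => if ∃ i, d = Finsupp.single i r then 1 else 0)
    (fun σ d => by
      have : (∃ i, d.mapDomain σ = Finsupp.single i r) ↔ ∃ i, d = Finsupp.single i r := by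
        constructor
        · rintro ⟨i, hi⟩
          refine ⟨σ.symm i, Finsupp.mapDomain_injective σ.injective ?_⟩
          rw [hi, Finsupp.mapDomain_single, Equiv.apply_symm_apply]
        · rintro ⟨i, rfl⟩
          exact ⟨σ i, Finsupp.mapDomain_single⟩
      by_cases hc : ∃ i, d = Finsupp.single i r
      · rw [if_pos hc, if_pos (this.2 hc)]
      · rw [if_neg hc, if_neg (mt this.1 hc)])
    ⟨r, fun d hd => if_neg (by
      rintro ⟨i, rfl⟩
      rw [Finsupp.degree_single] at hd
      exact lt_irrefl _ hd)⟩

/-- `e_μ = e_{μ₁} e_{μ₂} ⋯`. -/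
def eP {n : ℕ} (μ : n.Partition) : Sym := (μ.parts.map e).prod

/-- `h_μ = h_{μ₁} h_{μ₂} ⋯`. -/
def hP {n : ℕ} (μ : n.Partition) : Sym := (μ.parts.map h).prod

/-- `p_ν = p_{ν₁} p_{ν₂} ⋯`. -/
def pP {n : ℕ} (ν : n.Partition) : Sym := (ν.parts.map p).prod

/-- `z_ν = ∏ i, i ^ {m_i} m_i!`, where `m_i` is the multiplicity of `i` in `ν`. -/
def z {n : ℕ} (ν : n.Partition) : ℕ :=
  ∏ i ∈ ν.parts.toFinset, i ^ ν.parts.count i * (ν.parts.count i).factorial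

/-- The exponent vector `(s₁, s₂, …, s_ℓ, 0, 0, …)`, the parts being arranged in decreasing
order. -/
def expo (s : Multiset ℕ) : ℕ →₀ ℕ := (s.sort (· ≥ ·)).toFinsupp

/-- `[m_μ] f`, the coefficient of `m_μ` in the expansion of the symmetric function `f` in the
monomial basis, that is, the coefficient of `x₀ ^ μ₁ x₁ ^ μ₂ ⋯` in `f`. -/
def mcoeff {n : ℕ} (μ : n.Partition) (f : Sym) : ℚ := coeff (expo μ.parts) f

/-! ### The monomial expansion -/

theorem vals_expo (s : Multiset ℕ) (hs : 0 ∉ s) : vals (expo s) = s := by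
  classical
  have key : ∀ l : List ℕ, 0 ∉ l → vals l.toFinsupp = (l : Multiset ℕ) := by
    intro l
    induction l with
    | nil => intro _; simp [vals]
    | cons a l ih =>
      intro hl
      have ha : a ≠ 0 := fun h => hl (by simp [h])
      have hl' : 0 ∉ l := fun h => hl (by simp [h])
      have h1 : ((a :: l).toFinsupp).support
          = insert 0 (l.toFinsupp.support.map ⟨Nat.succ, Nat.succ_injective⟩) := by
        ext i
        cases i <;> simp [ha]
      have h2 : (0 : ℕ) ∉ l.toFinsupp.support.map ⟨Nat.succ, Nat.succ_injective⟩ := by simp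
      rw [vals, h1, Finset.insert_val_of_notMem h2, Multiset.map_cons, Finset.map_val,
        Multiset.map_map, ← Multiset.cons_coe, ← ih hl', vals]
      rfl
  have := key (s.sort (· ≥ ·)) (by simpa using hs)
  rw [Multiset.sort_eq] at this
  exact this

theorem zero_notMem_vals (d : ℕ →₀ ℕ) : 0 ∉ vals d := by
  simp [vals]

/-- Two exponent vectors with the same nonzero exponents differ by a permutation. -/
theorem exists_perm {d d' : ℕ →₀ ℕ} (hd : vals d = vals d') :
    ∃ σ : Equiv.Perm ℕ, d.mapDomain σ = d' := by
  classical
  have hcard : ∀ (d : ℕ →₀ ℕ) (c : ℕ), c ≠ 0 →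
      Multiset.count c (vals d) = Nat.card {a // d a = c} := by
    intro d c hc
    rw [vals, Multiset.count_map]
    have : {a | d a = c} = ((d.support.filter fun a => c = d a : Finset ℕ) : Set ℕ) := by
      ext a; simp only [Set.mem_ofPred_eq, Finset.coe_filter, Finsupp.mem_support_iff]
      constructor
      · rintro rfl; exact ⟨hc, rfl⟩
      · rintro ⟨_, h⟩; exact h.symm
    have h2 : Nat.card {a // d a = c} = Set.ncard {a | d a = c} := rfl
    rw [h2, this, Set.ncard_coe_finset]
    rfl
  have hfin : ∀ (d : ℕ →₀ ℕ) (c : ℕ), c ≠ 0 → Finite {a // d a = c} := by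
    intro d c hc
    have h3 : Set.Finite {a | d a = c} := by
      refine d.support.finite_toSet.subset fun a ha => ?_
      have ha' : d a = c := ha
      simp [ha', hc]
    exact h3.to_subtype
  have hinf : ∀ d : ℕ →₀ ℕ, Infinite {a // d a = 0} := by
    intro d
    have : {a | d a = 0} = ((d.support : Set ℕ))ᶜ := by ext a; simp
    have h3 : Set.Infinite {a | d a = 0} := by
      rw [this]; exact d.support.finite_toSet.infinite_compl
    exact h3.to_subtype
  have hE : ∀ c, Nonempty ({a // d a = c} ≃ {b // d' b = c}) := by
    intro c
    by_cases hc : c = 0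
    · subst hc
      have := hinf d
      have := hinf d'
      obtain ⟨i1⟩ := nonempty_denumerable {a // d a = 0}
      obtain ⟨i2⟩ := nonempty_denumerable {a // d' a = 0}
      exact ⟨Denumerable.equiv₂ _ _⟩
    · have := hfin d c hc
      have := hfin d' c hc
      have hce : Nat.card {a // d a = c} = Nat.card {b // d' b = c} := by
        rw [← hcard d c hc, ← hcard d' c hc, hd]
      exact Finite.card_eq.1 hce
  let σ : Equiv.Perm ℕ := Equiv.ofFiberEquiv fun c => (hE c).some
  refine ⟨σ, ?_⟩
  ext b
  obtain ⟨a, rfl⟩ := σ.surjective b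
  rw [Finsupp.mapDomain_apply σ.injective]
  exact (Equiv.ofFiberEquiv_map (fun c => (hE c).some) a).symm

theorem coeff_congr (f : Sym) {d d' : ℕ →₀ ℕ} (hd : vals d = vals d') :
    coeff d f = coeff d' f := by
  obtain ⟨σ, rfl⟩ := exists_perm hd
  rw [coeff_mapDomain]

theorem coeff_expo_vals (f : Sym) (d : ℕ →₀ ℕ) : coeff (expo (vals d)) f = coeff d f :=
  coeff_congr f (vals_expo _ (zero_notMem_vals d))

theorem zero_notMem_parts {n : ℕ} (μ : n.Partition) : 0 ∉ μ.parts :=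
  fun h => lt_irrefl 0 (μ.parts_pos h)

/-- `mcoeff` is dual to the monomial symmetric functions. -/
theorem mcoeff_m {n k : ℕ} (μ : n.Partition) (ν : k.Partition) :
    mcoeff μ (m ν.parts) = if μ.parts = ν.parts then 1 else 0 := by
  rw [mcoeff, m, coeff_ofCoeff, vals_expo _ (zero_notMem_parts μ)]

/-- `mcoeff` gives the coefficients of the (finite) monomial expansion. -/
theorem eq_sum_mcoeff (f : Sym) : ∃ N : ℕ, ∀ M, N ≤ M →
    f = ∑ n ∈ Finset.range M, ∑ μ : n.Partition, mcoeff μ f • m μ.parts := by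
  obtain ⟨N, hN⟩ := f.2.2
  refine ⟨N + 1, fun M hM => ?_⟩
  ext d
  simp only [map_sum, map_smul, smul_eq_mul]
  let μ₀ : (d.degree).Partition :=
    ⟨vals d, fun {i} hi => Nat.pos_of_ne_zero fun h0 => zero_notMem_vals d (h0 ▸ hi), rfl⟩
  have hm : ∀ (n : ℕ) (μ : n.Partition),
      mcoeff μ f * coeff d (m μ.parts) = if vals d = μ.parts then coeff d f else 0 := by
    intro n μ
    rw [m, coeff_ofCoeff]
    split_ifs with hv
    · rw [mul_one, mcoeff, ← hv, coeff_expo_vals]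
    · rw [mul_zero]
  simp only [hm]
  by_cases hd : d.degree < M
  · rw [Finset.sum_eq_single d.degree]
    · rw [Finset.sum_eq_single μ₀]
      · rw [if_pos rfl]
      · intro μ _ hμ
        exact if_neg fun hv => hμ (Nat.Partition.ext hv.symm)
      · simp
    · intro n _ hn
      refine Finset.sum_eq_zero fun μ _ => if_neg fun hv => hn ?_
      rw [degree_eq_sum_vals, hv, μ.parts_sum]
    · simp [hd]
  · have h0 : coeff d f = 0 := hN d (by omega)
    simp [h0]

/-! ### The partition division map -/

/-- The linear map `ρ_k` on symmetric functions, dividing all exponents by `k` and killing the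
monomials with an exponent not divisible by `k`. On the monomial basis, `ρ_k (m_{kμ}) = m_μ`, and
`ρ_k (m_μ) = 0` if some part of `μ` is not divisible by `k`. -/
def rho (k : ℕ) [NeZero k] : Sym →ₗ[ℚ] Sym where
  toFun f := ofCoeff (fun d => coeff (k • d) f)
    (fun σ d => by
      have : k • d.mapDomain σ = (k • d).mapDomain σ := by
        rw [Finsupp.mapDomain_smul]
      rw [this, coeff_mapDomain])
    (by
      obtain ⟨N, hN⟩ := f.2.2
      refine ⟨N, fun d hd => hN _ ?_⟩
      rw [map_nsmul, smul_eq_mul]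
      exact lt_of_lt_of_le hd (Nat.le_mul_of_pos_left _ (NeZero.pos k)))
  map_add' _ _ := rfl
  map_smul' _ _ := rfl

theorem vals_smul (k : ℕ) [NeZero k] (d : ℕ →₀ ℕ) : vals (k • d) = (vals d).map (k * ·) := by
  have : (k • d).support = d.support := by
    ext i; simp [NeZero.ne k]
  rw [vals, this, vals, Multiset.map_map]
  rfl

theorem rho_m_mul (k : ℕ) [NeZero k] (s : Multiset ℕ) : rho k (m (s.map (k * ·))) = m s := by
  ext d
  change (if vals (k • d) = _ then (1 : ℚ) else 0) = if vals d = s then 1 else 0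
  rw [vals_smul]
  have := Multiset.map_injective (mul_right_injective₀ (NeZero.ne k))
  simp only [this.eq_iff]

theorem rho_m_of_not_dvd (k : ℕ) [NeZero k] (s : Multiset ℕ) (hs : ∃ a ∈ s, ¬ k ∣ a) :
    rho k (m s) = 0 := by
  ext d
  change (if vals (k • d) = _ then (1 : ℚ) else 0) = 0
  rw [if_neg]
  rintro rfl
  obtain ⟨a, ha, hka⟩ := hs
  rw [vals_smul, Multiset.mem_map] at ha
  obtain ⟨b, -, rfl⟩ := ha
  exact hka (dvd_mul_right _ _)

/-! ### The fundamental theorem and the involution `ω` -/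

theorem coeff_mul (d : ℕ →₀ ℕ) (f g : Sym) :
    coeff d (f * g) = ∑ q ∈ Finset.HasAntidiagonal.antidiagonal d, coeff q.1 f * coeff q.2 g := by
  classical
  change MvPowerSeries.coeff d (toSeries (f * g)) = _
  rw [map_mul, MvPowerSeries.coeff_mul]
  rfl

theorem coeff_one (d : ℕ →₀ ℕ) : coeff d (1 : Sym) = if d = 0 then 1 else 0 := by
  classical
  change MvPowerSeries.coeff d (toSeries 1) = _
  rw [map_one, MvPowerSeries.coeff_one]

theorem coeff_e (d : ℕ →₀ ℕ) (n : ℕ) [Decidable ((∀ i, d i ≤ 1) ∧ d.degree = n)] :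
    coeff d (e n) = if (∀ i, d i ≤ 1) ∧ d.degree = n then 1 else 0 := by
  rw [e, coeff_ofCoeff]
  by_cases hc : (∀ i, d i ≤ 1) ∧ d.degree = n
  · rw [if_pos hc, if_pos hc]
  · rw [if_neg hc, if_neg hc]

theorem coeff_h (d : ℕ →₀ ℕ) (n : ℕ) : coeff d (h n) = if d.degree = n then 1 else 0 := rfl

/-- The algebra homomorphism sending the variable `X i` to `e_{i+1}`. -/
def eHom : MvPolynomial ℕ ℚ →ₐ[ℚ] Sym := MvPolynomial.aeval fun i => e (i + 1)

/-- Restriction of a symmetric function to the first `N` variables. -/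
def restr (N : ℕ) : Sym →ₐ[ℚ] MvPowerSeries (Fin N) ℚ :=
  (MvPowerSeries.killCompl Fin.valEmbedding).comp toSeries

theorem coeff_restr (N : ℕ) (f : Sym) (d : Fin N →₀ ℕ) :
    MvPowerSeries.coeff d (restr N f) = coeff (d.embDomain Fin.valEmbedding) f :=
  MvPowerSeries.coeff_killCompl _ _

theorem restr_e (N n : ℕ) :
    restr N (e n) = (MvPolynomial.esymm (Fin N) ℚ n : MvPowerSeries (Fin N) ℚ) := by
  classical
  ext d
  rw [coeff_restr, MvPolynomial.coeff_coe, MvPolynomial.esymm_eq_sum_monomial,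
    MvPolynomial.coeff_sum, coeff_e]
  simp only [MvPolynomial.coeff_monomial]
  have hdeg : (d.embDomain Fin.valEmbedding).degree = d.degree := by
    rw [degree_eq_sum_vals, vals_embDomain, ← degree_eq_sum_vals]
  have hle : (∀ i, d.embDomain Fin.valEmbedding i ≤ 1) ↔ ∀ i, d i ≤ 1 := by
    constructor
    · intro H i
      have := H (Fin.valEmbedding i)
      rwa [Finsupp.embDomain_apply_self] at this
    · intro H i
      by_cases hi : i ∈ Set.range (Fin.valEmbedding (n := N))
      · obtain ⟨j, rfl⟩ := hi
        rw [Finsupp.embDomain_apply_self]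
        exact H j
      · rw [Finsupp.embDomain_of_notMem_range _ _ _ hi]
        exact Nat.zero_le _
  have hind : ∀ (t : Finset (Fin N)) (i : Fin N),
      (∑ j ∈ t, Finsupp.single j 1 : Fin N →₀ ℕ) i = if i ∈ t then 1 else 0 := by
    intro t i
    rw [Finsupp.finsetSum_apply]
    simp [Finsupp.single_apply]
  have hsupp : ∀ t : Finset (Fin N), (∑ j ∈ t, Finsupp.single j 1 : Fin N →₀ ℕ).support = t := by
    intro t
    ext i
    rw [Finsupp.mem_support_iff, hind]
    simp
  rw [hdeg]
  simp only [hle]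
  split_ifs with hd
  · obtain ⟨hd1, hd2⟩ := hd
    have hs : (∑ j ∈ d.support, Finsupp.single j 1 : Fin N →₀ ℕ) = d := by
      ext i
      rw [hind]
      have := hd1 i
      by_cases hi : d i = 0
      · simp [hi]
      · simp only [Finsupp.mem_support_iff, ne_eq, hi, not_false_eq_true, if_true]
        omega
    have hcard : d.support.card = n := by
      rw [← hd2, ← hs, map_sum]
      simp [hs]
    rw [Finset.sum_eq_single d.support]
    · rw [if_pos hs]
    · intro t _ ht
      refine if_neg fun h => ht ?_
      rw [← h, hsupp]
    · intro h
      exact absurd (Finset.mem_powersetCard.2 ⟨Finset.subset_univ _, hcard⟩) h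
  · symm
    refine Finset.sum_eq_zero fun t ht => if_neg ?_
    rintro rfl
    refine hd ⟨fun i => ?_, ?_⟩
    · rw [hind]; split_ifs <;> omega
    · rw [map_sum]
      simpa using (Finset.mem_powersetCard.1 ht).2

theorem restr_eHom (N : ℕ) (P : MvPolynomial (Fin N) ℚ) :
    restr N (eHom (MvPolynomial.rename Fin.val P)) =
      ((MvPolynomial.esymmAlgHom (Fin N) ℚ N P : MvPolynomial (Fin N) ℚ) :
        MvPowerSeries (Fin N) ℚ) := by
  have : ((restr N).comp eHom).comp (MvPolynomial.rename Fin.val) =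
      ((MvPolynomial.coeToMvPowerSeries.algHom ℚ).comp
        (MvPolynomial.symmetricSubalgebra (Fin N) ℚ).val).comp
          (MvPolynomial.esymmAlgHom (Fin N) ℚ N) := by
    refine MvPolynomial.algHom_ext fun i => ?_
    simp only [AlgHom.comp_apply, MvPolynomial.rename_X, eHom, MvPolynomial.aeval_X, restr_e,
      MvPolynomial.esymmAlgHom]
    simp
  have h2 := DFunLike.congr_fun this P
  simpa using h2

theorem eHom_injective : Function.Injective eHom := by
  rw [injective_iff_map_eq_zero]
  intro P hP
  obtain ⟨N, hN⟩ : ∃ N : ℕ, ∀ i ∈ P.vars, i < N :=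
    ⟨P.vars.sup id + 1, fun i hi => Nat.lt_succ_of_le (Finset.le_sup (f := id) hi)⟩
  obtain ⟨Q, rfl⟩ := MvPolynomial.exists_rename_eq_of_vars_subset_range P (Fin.val : Fin N → ℕ)
    Fin.val_injective (fun i hi => ⟨⟨i, hN i hi⟩, rfl⟩)
  have h1 := restr_eHom N Q
  rw [hP, map_zero] at h1
  have h2 : (MvPolynomial.esymmAlgHom (Fin N) ℚ N Q : MvPolynomial (Fin N) ℚ) = 0 := by
    apply MvPolynomial.coe_injective
    rw [← h1, MvPolynomial.coe_zero]
  have h3 : Q = 0 := by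
    apply MvPolynomial.esymmAlgHom_injective (σ := Fin N) ℚ (n := N) (by simp)
    rw [map_zero]
    exact Subtype.ext h2
  rw [h3, map_zero]

theorem eq_zero_of_restr_eq_zero {f : Sym} {N : ℕ}
    (hN : ∀ d : ℕ →₀ ℕ, N < d.degree → coeff d f = 0) (hf : restr N f = 0) : f = 0 := by
  ext d
  change coeff d f = 0
  by_cases hd : N < d.degree
  · exact hN d hd
  have hlen : ((vals d).sort (· ≥ ·)).length ≤ N := by
    rw [Multiset.length_sort]
    refine le_trans ?_ (not_lt.1 hd)
    rw [degree_eq_sum_vals]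
    have := Multiset.card_nsmul_le_sum (s := vals d) (a := 1) (fun x hx =>
      Nat.pos_of_ne_zero fun h0 => zero_notMem_vals d (h0 ▸ hx))
    simpa using this
  obtain ⟨x, hx⟩ : ∃ x : Fin N →₀ ℕ, x.embDomain Fin.valEmbedding = expo (vals d) := by
    rw [← Set.mem_range, Finsupp.mem_range_embDomain_iff]
    intro i hi
    by_contra hr
    have hi' : N ≤ i := by
      by_contra hlt
      exact hr ⟨⟨i, not_le.1 hlt⟩, rfl⟩
    have : expo (vals d) i ≠ 0 := by simpa using hi
    exact this (List.toFinsupp_apply_le _ _ (hlen.trans hi'))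
  rw [← coeff_expo_vals, ← hx, ← coeff_restr, hf, map_zero]

theorem coeff_eHom_monomial (t : ℕ →₀ ℕ) : ∀ (c : ℚ) (d : ℕ →₀ ℕ),
    coeff d (eHom (MvPolynomial.monomial t c)) ≠ 0 →
      d.degree = Finsupp.weight (fun i : ℕ => i + 1) t := by
  have hmul : ∀ (f g : Sym) (a b : ℕ), (∀ d, coeff d f ≠ 0 → d.degree = a) →
      (∀ d, coeff d g ≠ 0 → d.degree = b) → ∀ d, coeff d (f * g) ≠ 0 → d.degree = a + b := by
    intro f g a b hf hg d hd
    rw [coeff_mul] at hd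
    obtain ⟨q, hq, hne⟩ := Finset.exists_ne_zero_of_sum_ne_zero hd
    rw [← Finset.HasAntidiagonal.mem_antidiagonal.1 hq, map_add, hf _ (left_ne_zero_of_mul hne),
      hg _ (right_ne_zero_of_mul hne)]
  have hC : ∀ (c : ℚ) (d : ℕ →₀ ℕ), coeff d (eHom (MvPolynomial.C c)) ≠ 0 → d.degree = 0 := by
    intro c d hd
    have h1 : eHom (MvPolynomial.C c) = c • (1 : Sym) := by
      rw [← MvPolynomial.algebraMap_eq, AlgHom.commutes, Algebra.algebraMap_eq_smul_one]
    rw [h1] at hd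
    have h2 : coeff d (c • (1 : Sym)) = c * coeff d 1 := rfl
    rw [h2, coeff_one] at hd
    by_contra h0
    apply hd
    rw [if_neg, mul_zero]
    rintro rfl
    exact h0 (map_zero _)
  induction t using Finsupp.induction_linear with
  | zero =>
    intro c d hd
    rw [map_zero]
    exact hC c d hd
  | add a b ha hb =>
    intro c d hd
    rw [map_add]
    have : MvPolynomial.monomial (a + b) c
        = MvPolynomial.monomial a 1 * MvPolynomial.monomial b c := by
      rw [MvPolynomial.monomial_mul, one_mul]
    rw [this, map_mul] at hd
    exact hmul _ _ _ _ (ha 1) (hb c) d hd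
  | single i k =>
    intro c d hd
    rw [← MvPolynomial.C_mul_X_pow_eq_monomial, map_mul, map_pow] at hd
    have hX : eHom (MvPolynomial.X i) = e (i + 1) := by rw [eHom, MvPolynomial.aeval_X]
    rw [hX] at hd
    have hpow : ∀ (k : ℕ) (d : ℕ →₀ ℕ), coeff d (e (i + 1) ^ k) ≠ 0 →
        d.degree = k * (i + 1) := by
      intro k
      induction k with
      | zero =>
        intro d hd
        rw [pow_zero, coeff_one] at hd
        by_contra h0
        refine hd (if_neg ?_)
        rintro rfl
        exact h0 (by simp)
      | succ k ih =>
        intro d hd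
        rw [pow_succ] at hd
        rw [add_mul, one_mul]
        refine hmul _ _ _ _ ih (fun d hd => ?_) d hd
        classical
        rw [coeff_e] at hd
        by_contra h0
        exact hd (if_neg fun h => h0 h.2)
    have := hmul _ _ _ _ (hC c) (hpow k) d hd
    rw [this, Finsupp.weight_single, zero_add, smul_eq_mul]

theorem eHom_surjective : Function.Surjective eHom := by
  classical
  intro f
  obtain ⟨N, hN⟩ := f.2.2
  replace hN : ∀ d : ℕ →₀ ℕ, N < d.degree → coeff d f = 0 := hN
  have hdeg : ∀ d : Fin N →₀ ℕ, (d.embDomain Fin.valEmbedding).degree = d.degree := by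
    intro d
    rw [degree_eq_sum_vals, vals_embDomain, ← degree_eq_sum_vals]
  set g : MvPolynomial (Fin N) ℚ := MvPowerSeries.truncTotal (N + 1) (restr N f) with hg
  have hgc : ∀ d, g.coeff d = coeff (d.embDomain Fin.valEmbedding) f := by
    intro d
    rw [hg, MvPowerSeries.coeff_truncTotal_eq_ite, coeff_restr]
    split_ifs with h
    · rfl
    · rw [hN]
      rw [hdeg]
      omega
  have hgr : (g : MvPowerSeries (Fin N) ℚ) = restr N f := by
    ext d
    rw [MvPolynomial.coeff_coe, hgc, coeff_restr]
  have hsymm : g.IsSymmetric := by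
    intro σ
    ext d
    obtain ⟨d', rfl⟩ : ∃ d' : Fin N →₀ ℕ, d'.mapDomain σ = d :=
      ⟨d.mapDomain σ.symm, by rw [← Finsupp.mapDomain_comp]; simp⟩
    rw [MvPolynomial.coeff_rename_mapDomain _ σ.injective, hgc, hgc]
    refine coeff_congr f ?_
    rw [vals_embDomain, vals_embDomain, vals_mapDomain]
  obtain ⟨P, hP⟩ := MvPolynomial.esymmAlgHom_surjective (σ := Fin N) ℚ (n := N) (by simp)
    ⟨g, hsymm⟩
  set Q : MvPolynomial ℕ ℚ := MvPolynomial.rename Fin.val P with hQ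
  have hQr : restr N (eHom Q) = restr N f := by
    rw [hQ, restr_eHom, hP, hgr]
  let w : (ℕ →₀ ℕ) → ℕ := fun t => Finsupp.weight (fun i : ℕ => i + 1) t
  let Q₁ : MvPolynomial ℕ ℚ :=
    ∑ t ∈ Q.support with w t ≤ N, MvPolynomial.monomial t (Q.coeff t)
  let Q₂ : MvPolynomial ℕ ℚ :=
    ∑ t ∈ Q.support with ¬ w t ≤ N, MvPolynomial.monomial t (Q.coeff t)
  have hsum : Q₁ + Q₂ = Q := by
    rw [Finset.sum_filter_add_sum_filter_not]
    exact (MvPolynomial.as_sum Q).symm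
  have hcoeff : ∀ (s : Finset (ℕ →₀ ℕ)) (d : ℕ →₀ ℕ),
      coeff d (eHom (∑ t ∈ s, MvPolynomial.monomial t (Q.coeff t))) ≠ 0 →
        ∃ t ∈ s, d.degree = w t := by
    intro s d hd
    have h1 : coeff d (eHom (∑ t ∈ s, MvPolynomial.monomial t (Q.coeff t)))
        = ∑ t ∈ s, coeff d (eHom (MvPolynomial.monomial t (Q.coeff t))) := by
      rw [map_sum, map_sum]
    rw [h1] at hd
    obtain ⟨t, ht, hne⟩ := Finset.exists_ne_zero_of_sum_ne_zero hd
    exact ⟨t, ht, coeff_eHom_monomial t _ d hne⟩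
  have h1 : ∀ d : ℕ →₀ ℕ, N < d.degree → coeff d (eHom Q₁) = 0 := by
    intro d hd
    by_contra hne
    obtain ⟨t, ht, hdt⟩ := hcoeff _ d hne
    have := (Finset.mem_filter.1 ht).2
    omega
  have h2 : ∀ d : ℕ →₀ ℕ, d.degree ≤ N → coeff d (eHom Q₂) = 0 := by
    intro d hd
    by_contra hne
    obtain ⟨t, ht, hdt⟩ := hcoeff _ d hne
    have := (Finset.mem_filter.1 ht).2
    omega
  refine ⟨Q₁, (sub_eq_zero.1 ?_).symm⟩
  have hd1 : ∀ d : ℕ →₀ ℕ, N < d.degree → coeff d (f - eHom Q₁) = 0 := by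
    intro d hd
    rw [map_sub, hN d hd, h1 d hd, sub_zero]
  refine eq_zero_of_restr_eq_zero hd1 ?_
  ext d
  rw [map_zero]
  by_cases hd : N < d.degree
  · rw [coeff_restr]
    exact hd1 _ (by rwa [hdeg])
  · have h3 : restr N (f - eHom Q₁) = restr N (eHom Q₂) := by
      rw [map_sub, ← hQr, ← hsum, map_add, map_add, add_sub_cancel_left]
    rw [h3, coeff_restr]
    exact h2 _ (by rw [hdeg]; omega)

/-- The fundamental theorem of symmetric functions: `Λ` is the polynomial ring in
`e_1, e_2, …`. -/
def eEquiv : MvPolynomial ℕ ℚ ≃ₐ[ℚ] Sym :=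
  AlgEquiv.ofBijective eHom ⟨eHom_injective, eHom_surjective⟩

/-- The standard involution `ω` on symmetric functions: the algebra homomorphism `Λ → Λ` with
`ω e_n = h_n` for all `n`. It also satisfies `ω h_n = e_n`. -/
def omega : Sym →ₐ[ℚ] Sym :=
  (MvPolynomial.aeval fun i => h (i + 1)).comp (eEquiv.symm : Sym →ₐ[ℚ] MvPolynomial ℕ ℚ)

theorem e_zero : e 0 = 1 := by
  classical
  ext d
  rw [coeff_e, coeff_one]
  refine if_congr ?_ rfl rfl
  rw [Finsupp.degree_eq_zero_iff]
  constructor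
  · exact fun h => h.2
  · rintro rfl
    simp

theorem h_zero : h 0 = 1 := by
  ext d
  rw [coeff_h, coeff_one]
  exact if_congr (Finsupp.degree_eq_zero_iff d) rfl rfl

theorem omega_e (n : ℕ) : omega (e n) = h n := by
  cases n with
  | zero => rw [e_zero, h_zero, map_one]
  | succ n =>
    have h1 : eEquiv (MvPolynomial.X n) = e (n + 1) := by
      change eHom _ = _
      rw [eHom, MvPolynomial.aeval_X]
    have h2 : eEquiv.symm (e (n + 1)) = MvPolynomial.X n := by
      rw [← h1, AlgEquiv.symm_apply_apply]
    change MvPolynomial.aeval _ (eEquiv.symm (e (n + 1))) = _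
    rw [h2, MvPolynomial.aeval_X]

/-- `∑ (-1)^i e_i h_{n-i} = 0` for `n ≥ 1`. -/
theorem sum_e_mul_h {n : ℕ} (hn : n ≠ 0) :
    ∑ q ∈ Finset.HasAntidiagonal.antidiagonal n, (-1 : Sym) ^ q.1 * (e q.1 * h q.2) = 0 := by
  classical
  have hsgn : ∀ (i : ℕ) (d : ℕ →₀ ℕ) (f : Sym),
      coeff d ((-1 : Sym) ^ i * f) = (-1) ^ i * coeff d f := by
    intro i d f
    rcases Nat.even_or_odd i with he | he
    · have h1 : (-1 : Sym) ^ i = 1 := he.neg_one_pow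
      rw [h1, one_mul, he.neg_one_pow, one_mul]
    · have h1 : (-1 : Sym) ^ i = -1 := he.neg_one_pow
      rw [h1, neg_one_mul, he.neg_one_pow, neg_one_mul]
      rfl
  ext d
  have hsum : coeff d (∑ q ∈ Finset.HasAntidiagonal.antidiagonal n, (-1 : Sym) ^ q.1 * (e q.1 * h q.2))
      = ∑ q ∈ Finset.HasAntidiagonal.antidiagonal n, coeff d ((-1 : Sym) ^ q.1 * (e q.1 * h q.2)) := map_sum _ _ _
  rw [hsum]
  simp only [hsgn, coeff_mul, Finset.mul_sum]
  rw [Finset.sum_comm]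
  have h0 : coeff d (0 : Sym) = 0 := rfl
  rw [h0]
  by_cases hd : d.degree = n
  · have hd0 : d.support.Nonempty := by
      rw [Finsupp.support_nonempty_iff]
      rintro rfl
      exact hn (by rw [← hd, map_zero])
    have step : ∀ a ∈ Finset.HasAntidiagonal.antidiagonal d,
        (∑ q ∈ Finset.HasAntidiagonal.antidiagonal n, (-1 : ℚ) ^ q.1 * (coeff a.1 (e q.1) * coeff a.2 (h q.2)))
          = if ∀ i, a.1 i ≤ 1 then (-1 : ℚ) ^ a.1.degree else 0 := by
      intro a ha
      have hadd : a.1.degree + a.2.degree = n := by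
        rw [← map_add, Finset.HasAntidiagonal.mem_antidiagonal.1 ha, hd]
      rw [Finset.sum_eq_single (a.1.degree, a.2.degree)]
      · rw [coeff_e, coeff_h]
        simp
      · intro q _ hq
        rw [coeff_e, coeff_h]
        by_cases h1 : a.1.degree = q.1
        · have h2 : a.2.degree ≠ q.2 := fun h2 => hq (by rw [h1, h2])
          simp [h2]
        · simp [h1]
      · intro hne
        exact absurd (Finset.HasAntidiagonal.mem_antidiagonal.2 hadd) hne
    rw [Finset.sum_congr rfl step, ← Finset.sum_filter]
    have hps : ∑ S ∈ d.support.powerset, (-1 : ℚ) ^ S.card = 0 := by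
      have := Finset.sum_powerset_neg_one_pow_card_of_nonempty hd0
      exact_mod_cast this
    rw [← hps]
    let ind : Finset ℕ → (ℕ →₀ ℕ) := fun S => Finsupp.indicator S fun _ _ => 1
    have hind : ∀ S i, ind S i = if i ∈ S then 1 else 0 := by
      intro S i
      simp [ind, Finsupp.indicator_apply]
    have hinds : ∀ S, (ind S).support = S := by
      intro S; ext i
      rw [Finsupp.mem_support_iff, hind]
      simp
    have hsupp : ∀ a : ℕ →₀ ℕ, (∀ i, a i ≤ 1) → ind a.support = a := by
      intro a ha
      ext i
      rw [hind]
      have := ha i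
      by_cases hi : a i = 0
      · simp [hi]
      · simp only [Finsupp.mem_support_iff, ne_eq, hi, not_false_eq_true, if_true]
        omega
    refine Finset.sum_nbij' (fun a => a.1.support) (fun S => (ind S, d - ind S)) ?_ ?_ ?_ ?_ ?_
    · intro a ha
      rw [Finset.mem_filter, Finset.HasAntidiagonal.mem_antidiagonal] at ha
      rw [Finset.mem_powerset, ← ha.1]
      intro i hi
      have : a.1 i ≠ 0 := by simpa using hi
      rw [Finsupp.mem_support_iff, Finsupp.add_apply]
      omega
    · intro S hS
      rw [Finset.mem_powerset] at hS
      rw [Finset.mem_filter, Finset.HasAntidiagonal.mem_antidiagonal]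
      refine ⟨?_, fun i => ?_⟩
      · ext i
        simp only [Finsupp.add_apply, Finsupp.tsub_apply, hind]
        split_ifs with hi
        · have : d i ≠ 0 := by simpa using hS hi
          omega
        · omega
      · change ind S i ≤ 1
        rw [hind]
        split_ifs <;> omega
    · intro a ha
      rw [Finset.mem_filter, Finset.HasAntidiagonal.mem_antidiagonal] at ha
      have h1 := hsupp a.1 ha.2
      refine Prod.ext h1 ?_
      change d - ind a.1.support = a.2
      rw [h1, ← ha.1, add_tsub_cancel_left]
    · intro S _
      exact hinds S
    · intro a ha
      rw [Finset.mem_filter] at ha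
      congr 1
      rw [Finsupp.degree_apply, Finset.card_eq_sum_ones]
      refine Finset.sum_congr rfl fun i hi => ?_
      have h1 := ha.2 i
      have h2 : a.1 i ≠ 0 := by simpa using hi
      omega
  · refine Finset.sum_eq_zero fun a ha => Finset.sum_eq_zero fun q hq => ?_
    rw [coeff_e, coeff_h]
    have hadd : a.1.degree + a.2.degree = d.degree := by
      rw [← map_add, Finset.HasAntidiagonal.mem_antidiagonal.1 ha]
    have hq' := Finset.HasAntidiagonal.mem_antidiagonal.1 hq
    by_cases h1 : a.1.degree = q.1
    · have h2 : a.2.degree ≠ q.2 := by omega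
      simp [h2]
    · simp [h1]

theorem omega_h (n : ℕ) : omega (h n) = e n := by
  induction n using Nat.strong_induction_on with
  | _ n ih =>
    by_cases hn : n = 0
    · subst hn
      rw [e_zero, h_zero, map_one]
    have h1 : ∑ q ∈ Finset.HasAntidiagonal.antidiagonal n, (-1 : Sym) ^ q.1 * (h q.1 * omega (h q.2)) = 0 := by
      have := congrArg omega (sum_e_mul_h hn)
      simpa only [map_sum, map_mul, map_pow, map_neg, map_one, map_zero, omega_e] using this
    have h2 : ∑ q ∈ Finset.HasAntidiagonal.antidiagonal n, (-1 : Sym) ^ q.1 * (h q.1 * e q.2) = 0 := by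
      have h3 : (-1 : Sym) ^ n *
          ∑ q ∈ Finset.HasAntidiagonal.antidiagonal n, (-1 : Sym) ^ q.1 * (e q.1 * h q.2) = 0 := by
        rw [sum_e_mul_h hn, mul_zero]
      rw [← Finset.Nat.sum_antidiagonal_swap, Finset.mul_sum] at h3
      rw [← h3]
      refine Finset.sum_congr rfl fun q hq => ?_
      have hq' := Finset.HasAntidiagonal.mem_antidiagonal.1 hq
      have hs : (-1 : Sym) ^ q.2 * (-1 : Sym) ^ q.2 = 1 := by
        rw [← mul_pow, neg_one_mul, neg_neg, one_pow]
      rw [← hq', pow_add, Prod.fst_swap, Prod.snd_swap]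
      linear_combination (-(-1 : Sym) ^ q.1 * (h q.1 * e q.2)) * hs
    have hmem : (0, n) ∈ Finset.HasAntidiagonal.antidiagonal n := by simp
    rw [← Finset.add_sum_erase _ _ hmem] at h1 h2
    have h4 : ∑ q ∈ (Finset.HasAntidiagonal.antidiagonal n).erase (0, n),
          (-1 : Sym) ^ q.1 * (h q.1 * omega (h q.2))
        = ∑ q ∈ (Finset.HasAntidiagonal.antidiagonal n).erase (0, n), (-1 : Sym) ^ q.1 * (h q.1 * e q.2) := by
      refine Finset.sum_congr rfl fun q hq => ?_
      rw [Finset.mem_erase, Finset.HasAntidiagonal.mem_antidiagonal] at hq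
      have hlt : q.2 < n := by
        by_contra hge
        exact hq.1 (Prod.ext (by omega : q.1 = 0) (by omega : q.2 = n))
      rw [ih _ hlt]
    rw [h4, ← h2] at h1
    have h5 := add_right_cancel h1
    simpa [h_zero] using h5

theorem omega_hP {n : ℕ} (μ : n.Partition) : omega (hP μ) = eP μ := by
  rw [hP, eP, map_multiset_prod, Multiset.map_map]
  exact congrArg _ (Multiset.map_congr rfl fun i _ => omega_h i)

theorem omega_omega (f : Sym) : omega (omega f) = f := by
  have : (omega.comp omega).comp eHom = eHom := by
    refine MvPolynomial.algHom_ext fun i => ?_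
    simp only [AlgHom.comp_apply, eHom, MvPolynomial.aeval_X, omega_e, omega_h]
  obtain ⟨P, rfl⟩ := eHom_surjective f
  exact DFunLike.congr_fun this P

/-! ### The symmetric functions `Φ_{k,r}` and `f_{k,r}`, and power sum positivity -/

/-- The power series `B_k(t) = ∑_{m ≥ 0} (-1)^m e_{km} t^m` over the ring of symmetric
functions. -/
def B (k : ℕ) : PowerSeries Sym := PowerSeries.mk fun j => (-1) ^ j * e (k * j)

/-- `Φ_{k,r} = - r [t^r] log B_k(t)`. -/
def Phi (k r : ℕ) : Sym := -((r : ℚ) • PowerSeries.coeff r (PowerSeries.logOf (B k)))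

/-- `f_{k,r} = ∑_{j=1}^r (-1)^{r+j} (r/j) ∑_α e_{kα₁} ⋯ e_{kα_j}`, the inner sum being over the
compositions `α` of `r` into `j` positive parts. -/
def fkr (k r : ℕ) : Sym :=
  ∑ j ∈ Finset.Icc 1 r, ((-1 : ℚ) ^ (r + j) * ((r : ℚ) / (j : ℚ))) •
    ∑ α : Composition r with α.length = j, (α.blocks.map fun a => e (k * a)).prod

/-- A symmetric function is `p`-positive if it is a finite linear combination of the functions
`p_ν / z_ν` with nonnegative integer coefficients; in particular its coefficients in the power sum
basis `p_ν` are nonnegative rational numbers. -/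
def IsPPositive (g : Sym) : Prop :=
  ∃ c : (Σ n : ℕ, n.Partition) →₀ ℕ, g = c.sum fun ν a => ((a : ℚ) / (z ν.2 : ℚ)) • pP ν.2

end SymFn

end

/-! Expansion. The coefficient of `x^d` in `ρ_k(e_μ)` counts the 0-1 matrices with row sums `μ` and
column sums `k d_i`. Transposing the matrices (`coeff_prod_e_comm`) turns it into `[m_μ] ∏ e_{k
d_i}`. Up to sign, the `Φ_{k,r}` are the coefficients of the logarithmic derivative of `B_k`, so the
sequence `e_{kn}` satisfies Newton relations with `(-1)^(r+1) Φ_{k,r}` in the role of the power sums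
(`isNewton_Phi`). For any Newton pair `(g, Ψ)` one has the Cauchy-type identity `∏ g_{d_i} = ∑_ν
z_ν⁻¹ [x^d] p_ν · Ψ_ν` (`prod_eq_sum_coeff_pP`). Taking `[m_μ]` expands `ρ_k(e_μ)` in power sums,
and `ω` multiplies `p_ν` by exactly the sign that cancels the signs of the `Φ` (`omega_pP`).
Uniqueness is the linear independence of the `p_ν` (`eq_of_sum_smul_pP_eq`).

Nonnegativity. In variables `y_1, …, y_N` let `A` have entries `y_j` for `i < j` and `D` entries
`y_j` for `i ≥ j`, so that `A + D = 1 yᵀ`. Then `T = A^(k-1) D` is `v yᵀ - A^k` with `v = A^(k-1)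
1`, a rank one perturbation of a nilpotent matrix, and `yᵀ A^m 1 = e_{m+1}`. Formally `det(1 - tT) =
B_k(t)`, whence `Φ_{k,r} = tr T^r` (`restr_Phi_eq_trace`), which visibly has natural coefficients.

The formula `Φ = f` is the expansion of the logarithm over compositions (`Phi_eq_fkr`). -/

namespace PowerSeries

/-! ### Powers and logarithms of formal power series. -/

theorem coeff_pow_eq_sum_composition {R : Type*} [CommSemiring R] {u : PowerSeries R}
    (hu : constantCoeff u = 0) (j r : ℕ) :
    coeff r (u ^ j) =
      ∑ α : Composition r with α.length = j, (α.blocks.map fun a => coeff a u).prod := by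
  classical
  induction j generalizing r with
  | zero =>
    rw [pow_zero, coeff_one]
    rcases Nat.eq_zero_or_pos r with rfl | hr
    · rw [if_pos rfl, Finset.sum_eq_single (⟨[], by simp, rfl⟩ : Composition 0)]
      · simp
      · intro α hα hne
        exact absurd (Composition.ext (List.eq_nil_of_length_eq_zero (Finset.mem_filter.1 hα).2)) hne
      · intro hne; exact (hne (by rw [Finset.mem_filter]; exact ⟨Finset.mem_univ _, rfl⟩)).elim
    · rw [if_neg hr.ne', Finset.sum_eq_zero]
      intro α hα
      have h1 := (Finset.mem_filter.1 hα).2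
      have h2 := α.length_pos_of_pos hr
      omega
  | succ j ih =>
    rw [pow_succ', coeff_mul]
    have h0 : ∀ q ∈ Finset.HasAntidiagonal.antidiagonal r, coeff q.1 u * coeff q.2 (u ^ j) ≠ 0 →
        q.1 ≠ 0 := by
      intro q _ hne hq
      rw [hq, coeff_zero_eq_constantCoeff_apply, hu, zero_mul] at hne
      exact hne rfl
    -- Only a nonzero index can be chosen in the first factor, so it serves as the first block of a
    -- composition; the other factors give the remaining blocks.
    rw [← Finset.sum_filter_of_ne h0]
    simp_rw [ih, Finset.mul_sum]
    rw [Finset.sum_sigma']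
    refine Finset.sum_bij (fun x hx => ⟨x.1.1 :: x.2.blocks, ?_, ?_⟩) ?_ ?_ ?_ ?_
    · intro i hi
      rw [Finset.mem_sigma, Finset.mem_filter] at hx
      rcases List.mem_cons.1 hi with rfl | hi
      · exact Nat.pos_of_ne_zero hx.1.2
      · exact x.2.blocks_pos hi
    · rw [Finset.mem_sigma, Finset.mem_filter, Finset.HasAntidiagonal.mem_antidiagonal] at hx
      rw [List.sum_cons, x.2.blocks_sum, hx.1.1]
    · intro x hx
      rw [Finset.mem_sigma, Finset.mem_filter, Finset.mem_filter] at hx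
      rw [Finset.mem_filter]
      refine ⟨Finset.mem_univ _, ?_⟩
      simpa [Composition.length] using hx.2.2
    · rintro ⟨⟨a, b⟩, α⟩ hx ⟨⟨a', b'⟩, α'⟩ hx' heq
      have h1 : a :: α.blocks = a' :: α'.blocks := congrArg Composition.blocks heq
      rw [List.cons.injEq] at h1
      obtain ⟨rfl, h2⟩ := h1
      simp only [Finset.mem_sigma, Finset.mem_filter, Finset.HasAntidiagonal.mem_antidiagonal]
        at hx hx'
      obtain rfl : b = b' := by omega
      obtain rfl : α = α' := Composition.ext h2
      rfl
    · intro α hα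
      rw [Finset.mem_filter] at hα
      obtain ⟨bl, hpos, hsum⟩ := α
      cases bl with
      | nil => simp [Composition.length] at hα
      | cons a l =>
        refine ⟨⟨(a, l.sum), ⟨l, fun {i} hi => hpos (List.mem_cons_of_mem _ hi), rfl⟩⟩, ?_, rfl⟩
        simp only [Finset.mem_sigma, Finset.mem_filter, Finset.HasAntidiagonal.mem_antidiagonal,
          Finset.mem_univ, true_and]
        refine ⟨⟨by simpa using hsum, (hpos List.mem_cons_self).ne'⟩, ?_⟩
        simpa [Composition.length] using hα.2
    · intro x _
      rw [List.map_cons, List.prod_cons]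

variable {A : Type*} [CommRing A] [Algebra ℚ A]

/-- The sum stops at `r` because `(f - 1) ^ j` has order at least `j`; it starts at 1 because the
logarithm series has no constant term. -/
theorem coeff_logOf {f : PowerSeries A} (hf : constantCoeff f = 1) (r : ℕ) :
    coeff r (logOf f) =
      ∑ j ∈ Finset.Icc 1 r, ((-1 : ℚ) ^ (j + 1) / j) • coeff r ((f - 1) ^ j) := by
  have hc : constantCoeff (f - 1) = 0 := by rw [map_sub, map_one, hf, sub_self]
  have hs : HasSubst (f - 1) := HasSubst.of_constantCoeff_zero' hc
  have h0 : ∀ j, r < j → coeff r ((f - 1) ^ j) = 0 := fun j hj =>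
    coeff_of_lt_order _ (lt_of_lt_of_le (by exact_mod_cast hj)
      (le_order_pow_of_constantCoeff_eq_zero j hc))
  rw [logOf_eq, coeff_subst' hs, finsum_eq_sum_of_support_subset (s := Finset.Icc 1 r)]
  · refine Finset.sum_congr rfl fun j hj => ?_
    have hj0 : j ≠ 0 := by have := (Finset.mem_Icc.1 hj).1; omega
    rw [coeff_log, if_neg hj0, smul_eq_mul, Algebra.smul_def]
  · intro j hj
    rw [Finset.coe_Icc, Set.mem_Icc]
    by_contra hlt
    refine hj ?_
    by_cases hj0 : j = 0
    · simp [hj0]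
    · change coeff j (log A) • coeff r ((f - 1) ^ j) = 0
      rw [h0 j (by omega), smul_zero]

/-- Chain rule: the derivative of `log (1 + X)` is inverse to `1 + X`, and substituting `f - 1` for
`X` makes it inverse to `f`. -/
theorem mul_derivative_logOf {f : PowerSeries A} (hf : constantCoeff f = 1) :
    f * derivative A (logOf f) = derivative A f := by
  have hc : constantCoeff (f - 1) = 0 := by rw [map_sub, map_one, hf, sub_self]
  have hs : HasSubst (f - 1) := HasSubst.of_constantCoeff_zero' hc
  have h1 : (1 + X) * derivative A (log A) = 1 := by
    rw [deriv_log]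
    ext n
    cases n with
    | zero => simp [add_mul]
    | succ n =>
      rw [add_mul, one_mul, map_add, coeff_succ_X_mul, coeff_mk, coeff_mk, ← map_add, pow_succ,
        mul_neg_one, neg_add_cancel, map_zero, coeff_one, if_neg n.succ_ne_zero]
  have h2 : f * (derivative A (log A)).subst (f - 1) = 1 := by
    have := congrArg (substAlgHom (R := A) hs) h1
    rw [map_mul, map_add, map_one, coe_substAlgHom, subst_X hs, add_sub_cancel] at this
    exact this
  rw [logOf_eq, derivative_subst hs, ← mul_assoc, h2, one_mul, map_sub, derivative_one, sub_zero]

end PowerSeries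

/-! ### Resolvents and the traces of a rank one perturbation. -/

namespace Matrix

open PowerSeries

variable {R ι : Type*} [CommRing R] [Fintype ι] [DecidableEq ι]

/-- The matrix of power series `∑ M ^ n t ^ n`. -/
def geomSeries (M : Matrix ι ι R) : Matrix ι ι (PowerSeries R) :=
  of fun i j => PowerSeries.mk fun n => (M ^ n) i j

theorem geomSeries_eq_one_add (M : Matrix ι ι R) :
    geomSeries M = 1 + (PowerSeries.X : PowerSeries R) • (M.map (C (R := R)) * geomSeries M) := by
  ext i j n
  rw [add_apply, smul_apply, smul_eq_mul, map_add, mul_apply, geomSeries, of_apply, coeff_mk]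
  cases n with
  | zero => rw [coeff_zero_X_mul, pow_zero, one_apply, one_apply]; split_ifs <;> simp
  | succ n =>
    rw [coeff_succ_X_mul, map_sum, pow_succ', mul_apply, one_apply]
    have : coeff (n + 1) (if i = j then 1 else 0 : PowerSeries R) = 0 := by
      split_ifs <;> simp [coeff_one]
    rw [this, zero_add]
    exact Finset.sum_congr rfl fun l _ => by rw [map_apply, coeff_C_mul, of_apply, coeff_mk]

theorem geomSeries_mul_comm (M : Matrix ι ι R) :
    M.map (C (R := R)) * geomSeries M = geomSeries M * M.map (C (R := R)) := by
  ext i j n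
  simp only [mul_apply, map_sum, map_apply, geomSeries, of_apply, coeff_C_mul, coeff_mul_C,
    coeff_mk]
  rw [← mul_apply, ← mul_apply, ← pow_succ, ← pow_succ']

/-- The factor `n + 1`, counting the splittings of `n`, is what will match a derivative in
`traceSeries_mul_eq`. -/
theorem coeff_geomSeries_mul_self (M : Matrix ι ι R) (i j : ι) (n : ℕ) :
    coeff n ((geomSeries M * geomSeries M) i j) = (n + 1) * (M ^ n) i j := by
  rw [mul_apply, map_sum]
  simp only [coeff_mul, geomSeries, of_apply, coeff_mk]
  rw [Finset.sum_comm]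
  have : ∀ q ∈ Finset.HasAntidiagonal.antidiagonal n,
      ∑ l, (M ^ q.1) i l * (M ^ q.2) l j = (M ^ n) i j := by
    intro q hq
    rw [← mul_apply, ← pow_add, Finset.HasAntidiagonal.mem_antidiagonal.1 hq]
  rw [Finset.sum_congr rfl this, Finset.sum_const, Finset.Nat.card_antidiagonal, nsmul_eq_mul]
  push_cast
  rfl

theorem coeff_dotProduct_geomSeries_mulVec (M : Matrix ι ι R) (v w : ι → R) (n : ℕ) :
    coeff n ((C (R := R) ∘ w) ⬝ᵥ (geomSeries M *ᵥ (C (R := R) ∘ v))) = w ⬝ᵥ ((M ^ n) *ᵥ v) := by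
  simp only [dotProduct, mulVec, map_sum, Function.comp_apply, coeff_C_mul, coeff_mul_C,
    geomSeries, of_apply, coeff_mk]

/-- If the traces of all positive powers of `S` vanish, then the generating function of the traces of the powers
of the rank one perturbation `v wᵀ - S` is the logarithmic derivative of the power series with
coefficients `(-1) ^ (m + 1) wᵀ S ^ m v`. -/
theorem traceSeries_mul_eq (S : Matrix ι ι R) (v w : ι → R)
    (hS : ∀ n, n ≠ 0 → (S ^ n).trace = 0) (B : PowerSeries R) (hB0 : constantCoeff B = 1)
    (hB : ∀ n, coeff (n + 1) B = (-1) ^ (n + 1) * (w ⬝ᵥ ((S ^ n) *ᵥ v))) :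
    PowerSeries.mk (fun n => if n = 0 then 0 else ((vecMulVec v w - S) ^ n).trace) * B
      = -(PowerSeries.X * derivative R B) := by
  set T := vecMulVec v w - S with hT
  set K := geomSeries (-S) with hK
  set L := geomSeries T with hL
  set v' : ι → PowerSeries R := C (R := R) ∘ v with hv'
  set w' : ι → PowerSeries R := C (R := R) ∘ w with hw'
  have hneg : ∀ n, w ⬝ᵥ (((-S) ^ n) *ᵥ v) = (-1) ^ n * (w ⬝ᵥ ((S ^ n) *ᵥ v)) := by
    intro n
    rcases Nat.even_or_odd n with h | h
    · rw [h.neg_pow, h.neg_one_pow, one_mul]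
    · rw [h.neg_pow, h.neg_one_pow, neg_mulVec, dotProduct_neg, neg_one_mul]
  have hnegtr : ∀ n, n ≠ 0 → ((-S) ^ n).trace = 0 := by
    intro n hn
    rcases Nat.even_or_odd n with h | h
    · rw [h.neg_pow, hS n hn]
    · rw [h.neg_pow, trace_neg, hS n hn, neg_zero]
  -- Here `K = (1 + XS)⁻¹` and `L = (1 - XT)⁻¹`. By the matrix determinant lemma the right side is
  -- `det(1 - XT) / det(1 + XS)`; the argument uses only resolvents, no determinants.
  have hBα : B = 1 - PowerSeries.X * (w' ⬝ᵥ (K *ᵥ v')) := by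
    ext n
    cases n with
    | zero => rw [map_sub, coeff_zero_X_mul, coeff_zero_eq_constantCoeff_apply, hB0]; simp
    | succ n =>
      rw [map_sub, coeff_succ_X_mul, coeff_dotProduct_geomSeries_mulVec, hneg, hB, coeff_one,
        if_neg n.succ_ne_zero, pow_succ]
      ring
  have hTmap : T.map (C (R := R)) = vecMulVec v' w' - S.map (C (R := R)) := by
    ext1 i j
    simp [hT, vecMulVec_apply, hv', hw']
  have hKS : K = 1 - (PowerSeries.X : PowerSeries R) • (K * S.map (C (R := R))) := by
    have h1 := geomSeries_eq_one_add (-S)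
    have h2 : (-S).map (C (R := R)) = - S.map (C (R := R)) := by ext1 i j; simp
    rw [geomSeries_mul_comm, h2, mul_neg, smul_neg, ← sub_eq_add_neg] at h1
    exact h1
  have hLT := geomSeries_eq_one_add T
  rw [hTmap, ← hL] at hLT
  -- Resolvent identity: the inverses of `K` and `L` differ by `X v wᵀ`. It comes from expanding `K
  -- * L` once through `L` and once through `K`.
  have hKL : K = L - (PowerSeries.X : PowerSeries R) • (K * vecMulVec v' w' * L) := by
    have h1 : K * L = K + (PowerSeries.X : PowerSeries R) •
        (K * vecMulVec v' w' * L - K * S.map (C (R := R)) * L) := by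
      conv_lhs => rw [hLT]
      rw [mul_add, mul_one, Matrix.mul_smul, sub_mul, mul_sub, mul_assoc, mul_assoc]
    have h2 : K * L = L - (PowerSeries.X : PowerSeries R) • (K * S.map (C (R := R)) * L) := by
      conv_lhs => rw [hKS]
      rw [sub_mul, one_mul, smul_mul]
    rw [h1, smul_sub] at h2
    rw [← add_sub_assoc] at h2
    exact eq_sub_of_add_eq (sub_left_inj.1 h2)
  set α := w' ⬝ᵥ (K *ᵥ v') with hα
  have hrow : w' ᵥ* K = B • (w' ᵥ* L) := by
    have h1 : w' ᵥ* K = w' ᵥ* L - (PowerSeries.X : PowerSeries R) • (α • (w' ᵥ* L)) := by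
      conv_lhs => rw [hKL]
      rw [vecMul_sub, vecMul_smul, ← vecMul_vecMul, ← vecMul_vecMul, vecMul_vecMulVec,
        ← dotProduct_mulVec, smul_vecMul]
    rw [h1, hBα, sub_smul, one_smul, mul_smul]
  have htr : L.trace - K.trace = PowerSeries.X * ((w' ᵥ* L) ⬝ᵥ (K *ᵥ v')) := by
    have h1 := congrArg trace hKL
    rw [trace_sub, trace_smul, mul_vecMulVec, vecMulVec_mul, trace_vecMulVec, smul_eq_mul,
      dotProduct_comm] at h1
    rw [h1, sub_sub_cancel]
  -- The factor `B` converts the row `wᵀ L` into `wᵀ K`, which eliminates `L`; the remaining `K * K`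
  -- yields the derivative of `B`.
  have htr2 : (L.trace - K.trace) * B = PowerSeries.X * (w' ⬝ᵥ ((K * K) *ᵥ v')) := by
    rw [htr, ← mulVec_mulVec, dotProduct_mulVec w', hrow, smul_dotProduct, smul_eq_mul]
    ring
  -- The constant terms of the two traces cancel, and `hS` removes every other coefficient of the
  -- trace of `K`.
  have hmk : PowerSeries.mk (fun n => if n = 0 then 0 else (T ^ n).trace)
      = L.trace - K.trace := by
    ext n
    have h1 : ∀ M : Matrix ι ι R, coeff n (geomSeries M).trace = (M ^ n).trace := by
      intro M
      simp only [trace, diag, map_sum, geomSeries, of_apply, coeff_mk]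
    rw [map_sub, h1, h1, coeff_mk]
    split_ifs with hn
    · rw [hn, pow_zero, pow_zero, sub_self]
    · rw [hnegtr n hn, sub_zero]
  rw [hmk, htr2, ← mul_neg]
  congr 1
  ext n
  rw [map_neg, coeff_derivative, hB]
  simp only [dotProduct, mulVec, map_sum, hv', hw', Function.comp_apply, coeff_C_mul, coeff_mul_C,
    hK, coeff_geomSeries_mul_self]
  have h4 := hneg n
  simp only [dotProduct, mulVec] at h4
  have h5 : ∑ i, w i * ∑ j, ((n : R) + 1) * ((-S) ^ n) i j * v j
      = (n + 1) * ∑ i, w i * ∑ j, ((-S) ^ n) i j * v j := by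
    simp only [Finset.mul_sum]
    exact Finset.sum_congr rfl fun i _ => Finset.sum_congr rfl fun j _ => by ring
  rw [h5, h4, pow_succ]
  ring

end Matrix

/-! ### Newton relations. -/

/-- The Newton relations `(n + 1) g_{n+1} = ∑_{i + j = n} Ψ_{i+1} g_j` between a sequence `g` and the
sequence `Ψ` of the coefficients of its logarithmic derivative. -/
def IsNewton {R : Type*} [CommRing R] (g Ψ : ℕ → R) : Prop :=
  g 0 = 1 ∧ ∀ n : ℕ, ((n : R) + 1) * g (n + 1) =
    ∑ q ∈ Finset.HasAntidiagonal.antidiagonal n, Ψ (q.1 + 1) * g q.2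

namespace IsNewton

variable {R S : Type*} [CommRing R] [CommRing S]

theorem map {g Ψ : ℕ → R} (hg : IsNewton g Ψ) (φ : R →+* S) :
    IsNewton (fun n => φ (g n)) (fun n => φ (Ψ n)) := by
  refine ⟨(congrArg φ hg.1).trans (map_one φ), fun n => ?_⟩
  have := congrArg φ (hg.2 n)
  simpa only [map_mul, map_add, map_natCast, map_one, map_sum] using this

/-- Since `g 0 = 1`, the term `Ψ (n + 1)` occurs with coefficient one in the `n`-th relation and is
determined by the earlier ones, without any division. -/
theorem log_unique {g Ψ Ψ' : ℕ → R} (hg : IsNewton g Ψ) (hg' : IsNewton g Ψ') (n : ℕ) :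
    Ψ (n + 1) = Ψ' (n + 1) := by
  induction n using Nat.strong_induction_on with
  | _ n ih =>
    have h1 := (hg.2 n).symm.trans (hg'.2 n)
    have hmem : (n, 0) ∈ Finset.HasAntidiagonal.antidiagonal n := by simp
    rw [← Finset.add_sum_erase _ _ hmem, ← Finset.add_sum_erase _ _ hmem, hg.1, mul_one,
      mul_one] at h1
    have h2 : ∑ q ∈ (Finset.HasAntidiagonal.antidiagonal n).erase (n, 0), Ψ (q.1 + 1) * g q.2
        = ∑ q ∈ (Finset.HasAntidiagonal.antidiagonal n).erase (n, 0), Ψ' (q.1 + 1) * g q.2 := by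
      refine Finset.sum_congr rfl fun q hq => ?_
      rw [Finset.mem_erase, Finset.HasAntidiagonal.mem_antidiagonal] at hq
      have hlt : q.1 < n := by
        by_contra hge
        exact hq.1 (Prod.ext (by omega : q.1 = n) (by omega : q.2 = 0))
      rw [ih _ hlt]
    rw [h2] at h1
    exact add_right_cancel h1

/-- The product of the `g_{d_i}` over an exponent vector `d` satisfies the Newton relations in
every variable. -/
theorem prod_eq {g Ψ : ℕ → R} (hg : IsNewton g Ψ) (d : ℕ →₀ ℕ) (n : ℕ) (hd : d.degree = n + 1) :
    ((n : R) + 1) * d.prod (fun _ a => g a) =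
      ∑ q ∈ Finset.HasAntidiagonal.antidiagonal n, Ψ (q.1 + 1) *
        ∑ i ∈ d.support with q.1 + 1 ≤ d i,
          (d - Finsupp.single i (q.1 + 1)).prod (fun _ a => g a) := by
  classical
  have hsub : ∀ i ∈ d.support, ∀ r, (d - Finsupp.single i r).prod (fun _ a => g a)
      = g (d i - r) * ∏ j ∈ d.support.erase i, g (d j) := by
    intro i hi r
    rw [Finsupp.prod_of_support_subset (s := d.support), ← Finset.mul_prod_erase _ _ hi]
    · congr 1
      · simp
      · refine Finset.prod_congr rfl fun j hj => ?_
        rw [Finsupp.tsub_apply, Finsupp.single_eq_of_ne (Finset.ne_of_mem_erase hj), tsub_zero]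
    · intro j hj
      rw [Finsupp.mem_support_iff, Finsupp.tsub_apply] at hj
      rw [Finsupp.mem_support_iff]
      omega
    · exact fun _ _ => hg.1
  have hle : ∀ i, d i ≤ n + 1 := fun i => hd ▸ Finsupp.le_degree i d
  -- The Leibniz rule: `n + 1` is the sum of the exponents, and the relation for `g (d i)` acts on
  -- one factor at a time. The guard excludes indices where truncated subtraction would produce a
  -- spurious `g 0 = 1`.
  have hterm : ∀ i ∈ d.support,
      ∑ q ∈ Finset.HasAntidiagonal.antidiagonal n,
        (if q.1 + 1 ≤ d i then Ψ (q.1 + 1) * g (d i - (q.1 + 1)) else 0) = (d i : R) * g (d i) := by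
    intro i hi
    obtain ⟨a, ha⟩ : ∃ a, d i = a + 1 := Nat.exists_eq_succ_of_ne_zero (Finsupp.mem_support_iff.1 hi)
    have han : a ≤ n := by have := hle i; omega
    rw [ha, Nat.cast_add, Nat.cast_one, hg.2 a, Finset.Nat.sum_antidiagonal_eq_sum_range_succ_mk,
      Finset.Nat.sum_antidiagonal_eq_sum_range_succ_mk, ← Finset.sum_filter]
    refine Finset.sum_congr ?_ fun j hj => ?_
    · ext j
      simp only [Finset.mem_filter, Finset.mem_range]
      omega
    · rw [Nat.add_sub_add_right]
  have hdeg : ((n : R) + 1) = ∑ i ∈ d.support, (d i : R) := by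
    rw [← Nat.cast_succ, Nat.succ_eq_add_one, ← hd, Finsupp.degree_apply, Nat.cast_sum]
  simp_rw [Finset.sum_filter, Finset.mul_sum]
  rw [Finset.sum_comm, hdeg, Finset.sum_mul]
  refine Finset.sum_congr rfl fun i hi => ?_
  rw [Finsupp.prod, ← Finset.mul_prod_erase _ _ hi, ← mul_assoc, ← hterm i hi, Finset.sum_mul]
  refine Finset.sum_congr rfl fun q _ => ?_
  split_ifs
  · rw [hsub i hi, mul_assoc]
  · rw [zero_mul, mul_zero]

end IsNewton

/-! ### Sums over partitions, power sum expansions and the action of `ω`. -/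

namespace SymFn

/-- `z_s` for a multiset `s` of positive integers. -/
def zMultiset (s : Multiset ℕ) : ℕ :=
  ∏ i ∈ s.toFinset, i ^ s.count i * (s.count i).factorial

theorem zMultiset_cons (r : ℕ) (s : Multiset ℕ) :
    zMultiset (r ::ₘ s) = r * (s.count r + 1) * zMultiset s := by
  have h1 : zMultiset s = ∏ i ∈ insert r s.toFinset, i ^ s.count i * (s.count i).factorial := by
    refine Finset.prod_subset (Finset.subset_insert _ _) fun i _ hi => ?_
    rw [Multiset.mem_toFinset, ← Multiset.count_eq_zero] at hi
    simp [hi]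
  have hr := Finset.mem_insert_self r s.toFinset
  rw [h1, zMultiset, Multiset.toFinset_cons, ← Finset.mul_prod_erase _ _ hr,
    ← Finset.mul_prod_erase _ _ hr, ← mul_assoc, Multiset.count_cons_self]
  congr 1
  · rw [pow_succ, Nat.factorial_succ]
    ring
  · refine Finset.prod_congr rfl fun i hi => ?_
    rw [Multiset.count_cons_of_ne (Finset.ne_of_mem_erase hi)]

theorem z_ne_zero {n : ℕ} (ν : n.Partition) : z ν ≠ 0 :=
  Finset.prod_ne_zero_iff.2 fun _ hi => mul_ne_zero
    (pow_ne_zero _ (ν.parts_pos (Multiset.mem_toFinset.1 hi)).ne') (Nat.factorial_ne_zero _)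

/-- Removing a part in the sum over the partitions weighted by `1 / z_ν`. -/
theorem sum_partition_succ {M : Type*} [AddCommGroup M] [Module ℚ M] (F : Multiset ℕ → M) (n : ℕ) :
    ((n : ℚ) + 1) • ∑ ν : (n + 1).Partition, (z ν : ℚ)⁻¹ • F ν.parts =
      ∑ q ∈ Finset.HasAntidiagonal.antidiagonal n,
        ∑ ν : q.2.Partition, (z ν : ℚ)⁻¹ • F ((q.1 + 1) ::ₘ ν.parts) := by
  classical
  -- Write `n + 1` as the sum of `r m_r(ν)` over the distinct parts `r`. Deleting one part `r` from
  -- `ν` divides `z_ν` by exactly `r m_r(ν)`, so the weights cancel. Below, `r = q.1 + 1`.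
  have h1 : ∀ ν : (n + 1).Partition, ((n : ℚ) + 1) • ((z ν : ℚ)⁻¹ • F ν.parts) =
      ∑ r ∈ ν.parts.toFinset, ((ν.parts.count r * r : ℕ) : ℚ) • ((z ν : ℚ)⁻¹ • F ν.parts) := by
    intro ν
    rw [← Finset.sum_smul, ← Nat.cast_sum]
    have h2 : ∑ r ∈ ν.parts.toFinset, ν.parts.count r * r = n + 1 := by
      refine Eq.trans ?_ ν.parts_sum
      rw [Finset.sum_multiset_count]
      rfl
    rw [h2]
    push_cast
    rfl
  rw [Finset.smul_sum, Finset.sum_congr rfl fun ν _ => h1 ν, Finset.sum_sigma', Finset.sum_sigma']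
  symm
  refine Finset.sum_bij (fun x hx => ⟨⟨(x.1.1 + 1) ::ₘ x.2.parts, ?_, ?_⟩, x.1.1 + 1⟩) ?_ ?_ ?_ ?_
  · intro i hi
    rcases Multiset.mem_cons.1 hi with rfl | hi
    · exact Nat.succ_pos _
    · exact x.2.parts_pos hi
  · rw [Finset.mem_sigma, Finset.HasAntidiagonal.mem_antidiagonal] at hx
    rw [Multiset.sum_cons, x.2.parts_sum, ← hx.1]
    ring
  · intro x _
    simp
  · rintro ⟨⟨a, b⟩, ν⟩ hx ⟨⟨a', b'⟩, ν'⟩ hx' heq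
    rw [Sigma.mk.injEq, heq_eq_eq] at heq
    obtain ⟨h2, h3⟩ := heq
    simp only [Finset.mem_sigma, Finset.HasAntidiagonal.mem_antidiagonal] at hx hx'
    simp only [Nat.add_right_cancel_iff] at h3
    subst h3
    obtain rfl : b = b' := by omega
    have h4 : ν.parts = ν'.parts :=
      (Multiset.cons_inj_right _).1 (congrArg Nat.Partition.parts h2)
    obtain rfl : ν = ν' := Nat.Partition.ext h4
    rfl
  · rintro ⟨ν, r⟩ hr
    have hr' : r ∈ ν.parts := by simpa using hr
    have hpos := ν.parts_pos hr'
    have hsum : r + (ν.parts.erase r).sum = n + 1 := by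
      rw [← Multiset.sum_cons, Multiset.cons_erase hr', ν.parts_sum]
    refine ⟨⟨(r - 1, (ν.parts.erase r).sum),
      ⟨ν.parts.erase r, fun hi => ν.parts_pos (Multiset.mem_of_mem_erase hi), rfl⟩⟩, ?_, ?_⟩
    · simp only [Finset.mem_sigma, Finset.HasAntidiagonal.mem_antidiagonal, Finset.mem_univ,
        and_true]
      omega
    · have h5 : r - 1 + 1 = r := by omega
      refine Sigma.ext (Nat.Partition.ext ?_) (heq_of_eq h5)
      change (r - 1 + 1) ::ₘ ν.parts.erase r = ν.parts
      rw [h5, Multiset.cons_erase hr']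
  · rintro ⟨q, ν⟩ _
    have h6 : (z ν : ℚ) ≠ 0 := Nat.cast_ne_zero.2 (z_ne_zero ν)
    change (z ν : ℚ)⁻¹ • F ((q.1 + 1) ::ₘ ν.parts) =
      ((((q.1 + 1) ::ₘ ν.parts).count (q.1 + 1) * (q.1 + 1) : ℕ) : ℚ) •
        ((zMultiset ((q.1 + 1) ::ₘ ν.parts) : ℚ)⁻¹ • F ((q.1 + 1) ::ₘ ν.parts))
    rw [smul_smul, zMultiset_cons, Multiset.count_cons_self]
    congr 1
    change _ = _ * ((((q.1 + 1) * (ν.parts.count (q.1 + 1) + 1) * z ν : ℕ) : ℚ))⁻¹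
    push_cast
    field_simp

/-- The coefficients of the generalized exponential: `g_n = ∑_{ν ⊢ n} Ψ_ν / z_ν` solves the Newton
relations. -/
theorem isNewton_sum_partition {R : Type*} [CommRing R] [Algebra ℚ R] (Ψ : ℕ → R) :
    IsNewton (fun n => ∑ ν : n.Partition, (z ν : ℚ)⁻¹ • (ν.parts.map Ψ).prod) Ψ := by
  refine ⟨?_, fun n => ?_⟩
  · change ∑ ν : Nat.Partition 0, _ = _
    rw [Fintype.sum_unique]
    have : (default : Nat.Partition 0).parts = 0 := rfl
    rw [z, this]
    simp
  · have h1 := sum_partition_succ (fun s => (s.map Ψ).prod) n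
    rw [Algebra.smul_def, map_add, map_natCast, map_one] at h1
    rw [h1]
    refine Finset.sum_congr rfl fun q _ => ?_
    rw [Finset.mul_sum]
    refine Finset.sum_congr rfl fun ν _ => ?_
    rw [Multiset.map_cons, Multiset.prod_cons, mul_smul_comm]

/-- A term of `p r` raises a single exponent by `r`. For `r = 0` the vectors `Finsupp.single i r`
all coincide and `i` could not be recovered. -/
theorem coeff_p_mul {r : ℕ} (hr : r ≠ 0) (f : Sym) (d : ℕ →₀ ℕ) :
    coeff d (p r * f) = ∑ i ∈ d.support with r ≤ d i, coeff (d - Finsupp.single i r) f := by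
  classical
  have hp : ∀ q : (ℕ →₀ ℕ) × (ℕ →₀ ℕ), coeff q.1 (p r) * coeff q.2 f =
      if ∃ i, q.1 = Finsupp.single i r then coeff q.2 f else 0 := by
    intro q
    rw [p, coeff_ofCoeff]
    by_cases hc : ∃ i, q.1 = Finsupp.single i r
    · rw [if_pos hc, if_pos hc, one_mul]
    · rw [if_neg hc, if_neg hc, zero_mul]
  rw [coeff_mul, Finset.sum_congr rfl fun q _ => hp q, ← Finset.sum_filter]
  symm
  refine Finset.sum_nbij (fun i => (Finsupp.single i r, d - Finsupp.single i r)) ?_ ?_ ?_ ?_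
  · intro i hi
    rw [Finset.mem_filter] at hi
    rw [Finset.mem_filter, Finset.HasAntidiagonal.mem_antidiagonal]
    exact ⟨add_tsub_cancel_of_le (Finsupp.single_le_iff.2 hi.2), i, rfl⟩
  · intro i _ j _ hij
    exact (Finsupp.single_left_inj hr).1 (congrArg Prod.fst hij)
  · rintro ⟨a, b⟩ hab
    rw [Finset.mem_coe, Finset.mem_filter, Finset.HasAntidiagonal.mem_antidiagonal] at hab
    obtain ⟨hab, i, hi⟩ := hab
    simp only at hab hi
    subst hi hab
    refine ⟨i, ?_, ?_⟩
    · rw [Finset.mem_coe, Finset.mem_filter, Finsupp.mem_support_iff]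
      simp only [Finsupp.add_apply, Finsupp.single_eq_same]
      omega
    · simp only [add_tsub_cancel_left]
  · intro i _
    rfl

theorem degree_sub_single {d : ℕ →₀ ℕ} {i r : ℕ} (hi : r ≤ d i) :
    (d - Finsupp.single i r).degree + r = d.degree := by
  conv_rhs => rw [← tsub_add_cancel_of_le (Finsupp.single_le_iff.2 hi)]
  rw [map_add, Finsupp.degree_single]

/-- A product over the parts of an exponent vector, expanded in power sums. -/
theorem prod_eq_sum_coeff_pP {R : Type*} [CommRing R] [Algebra ℚ R] {g Ψ : ℕ → R}
    (hg : IsNewton g Ψ) (n : ℕ) : ∀ d : ℕ →₀ ℕ, d.degree = n →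
      d.prod (fun _ a => g a) =
        ∑ ν : n.Partition, (z ν : ℚ)⁻¹ • (coeff d (pP ν) • (ν.parts.map Ψ).prod) := by
  induction n using Nat.strong_induction_on with
  | _ n ih =>
    intro d hd
    cases n with
    | zero =>
      obtain rfl := (Finsupp.degree_eq_zero_iff d).1 hd
      rw [Fintype.sum_unique]
      have : (default : Nat.Partition 0).parts = 0 := rfl
      rw [z, pP, this]
      simp [coeff_one]
    | succ n =>
      -- Both sides obey the same recursion: a part of `ν` is removed on the right, and one exponent
      -- of `d` is lowered by that amount on the left.
      have h1 := sum_partition_succ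
        (fun s => coeff d ((s.map p).prod) • (s.map Ψ).prod) n
      have hn : ((n : ℚ) + 1) ≠ 0 := by positivity
      have h2 : ((n : ℚ) + 1) • d.prod (fun _ a => g a) = ((n : R) + 1) * d.prod (fun _ a => g a) := by
        rw [Algebra.smul_def, map_add, map_natCast, map_one]
      refine (smul_right_injective R hn) ?_
      change ((n : ℚ) + 1) • _ = ((n : ℚ) + 1) • _
      refine Eq.trans ?_ h1.symm
      rw [h2, hg.prod_eq d n hd]
      refine Finset.sum_congr rfl fun q hq => ?_
      rw [Finset.HasAntidiagonal.mem_antidiagonal] at hq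
      have h3 : ∀ i ∈ d.support.filter (fun i => q.1 + 1 ≤ d i),
          (d - Finsupp.single i (q.1 + 1)).prod (fun _ a => g a) =
          ∑ ν : q.2.Partition, (z ν : ℚ)⁻¹ •
            (coeff (d - Finsupp.single i (q.1 + 1)) (pP ν) • (ν.parts.map Ψ).prod) := by
        intro i hi
        have h4 := degree_sub_single (Finset.mem_filter.1 hi).2
        exact ih q.2 (by omega) _ (by omega)
      rw [Finset.sum_congr rfl h3, Finset.sum_comm, Finset.mul_sum]
      refine Finset.sum_congr rfl fun ν _ => ?_
      rw [Multiset.map_cons, Multiset.prod_cons, Multiset.map_cons, Multiset.prod_cons,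
        coeff_p_mul q.1.succ_ne_zero, ← Finset.smul_sum, ← Finset.sum_smul, mul_smul_comm,
        mul_smul_comm]
      rfl

/-- A family of symmetric functions whose coefficients are multiplicative in the exponents
satisfies the Newton relations. -/
theorem isNewton_of_coeff_eq_prod {g Ψ : ℕ → ℚ} (hg : IsNewton g Ψ) (G : ℕ → Sym)
    (hG : ∀ n d, coeff d (G n) = if d.degree = n then d.prod (fun _ a => g a) else 0) :
    IsNewton G (fun r => Ψ r • p r) := by
  refine ⟨?_, fun n => ?_⟩
  · ext d
    rw [hG, coeff_one]
    by_cases hd : d = 0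
    · subst hd
      simp
    · rw [if_neg hd, if_neg fun h => hd ((Finsupp.degree_eq_zero_iff d).1 h)]
  · ext d
    have h1 : ((n : Sym) + 1) * G (n + 1) = ((n : ℚ) + 1) • G (n + 1) := by
      rw [Algebra.smul_def, map_add, map_natCast, map_one]
    rw [h1, map_smul, map_sum, hG, smul_eq_mul]
    have h2 : ∀ q : ℕ × ℕ, coeff d (Ψ (q.1 + 1) • p (q.1 + 1) * G q.2) = Ψ (q.1 + 1) *
        ∑ i ∈ d.support with q.1 + 1 ≤ d i, coeff (d - Finsupp.single i (q.1 + 1)) (G q.2) := by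
      intro q
      rw [smul_mul_assoc, map_smul, coeff_p_mul q.1.succ_ne_zero, smul_eq_mul]
    rw [Finset.sum_congr rfl fun q _ => h2 q]
    by_cases hd : d.degree = n + 1
    · rw [if_pos hd, hg.prod_eq d n hd]
      refine Finset.sum_congr rfl fun q hq => ?_
      rw [Finset.HasAntidiagonal.mem_antidiagonal] at hq
      congr 1
      refine Finset.sum_congr rfl fun i hi => ?_
      have h4 := degree_sub_single (Finset.mem_filter.1 hi).2
      rw [hG, if_pos (by omega)]
    · rw [if_neg hd, mul_zero]
      symm
      refine Finset.sum_eq_zero fun q hq => ?_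
      rw [Finset.HasAntidiagonal.mem_antidiagonal] at hq
      rw [Finset.sum_eq_zero, mul_zero]
      intro i hi
      have h4 := degree_sub_single (Finset.mem_filter.1 hi).2
      rw [hG, if_neg (by omega)]

/-- One variable contributes the series `1/(1 - t)`, with logarithmic derivative `1/(1 - t)`. -/
theorem isNewton_h : IsNewton h p := by
  have h1 : IsNewton (fun _ => (1 : ℚ)) (fun _ => 1) :=
    ⟨rfl, fun n => by simp [Finset.sum_const, Finset.Nat.card_antidiagonal]⟩
  have h2 := isNewton_of_coeff_eq_prod h1 h fun n d => by rw [coeff_h]; simp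
  simpa only [one_smul] using h2

/-- One variable contributes `1 + t`, with logarithmic derivative `1/(1 + t)`. For `n ≥ 1` only the
terms with `g 0` and `g 1` survive, and they have opposite signs. -/
theorem isNewton_e : IsNewton e (fun r => (-1 : ℚ) ^ (r + 1) • p r) := by
  classical
  have h1 : IsNewton (fun n => if n ≤ 1 then (1 : ℚ) else 0) (fun r => (-1) ^ (r + 1)) := by
    refine ⟨rfl, fun n => ?_⟩
    rcases n with _ | _ | n
    · simp
    · norm_num [Finset.Nat.sum_antidiagonal_succ']
    · rw [Finset.Nat.sum_antidiagonal_succ', Finset.Nat.sum_antidiagonal_succ',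
        Finset.sum_eq_zero]
      · simp [pow_succ]
      · intro q _
        simp
  refine isNewton_of_coeff_eq_prod h1 e fun n d => ?_
  rw [coeff_e]
  have h2 : d.prod (fun _ a => if a ≤ 1 then (1 : ℚ) else 0) =
      if ∀ i, d i ≤ 1 then 1 else 0 := by
    rw [Finsupp.prod, Finset.prod_ite_zero]
    refine if_congr ⟨fun H i => ?_, fun H i _ => H i⟩ (by simp) rfl
    by_cases hi : i ∈ d.support
    · exact H i hi
    · rw [Finsupp.notMem_support_iff.1 hi]
      exact Nat.zero_le _
  rw [h2]
  by_cases hd : d.degree = n <;> simp [hd]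

/-- Applying `ω` to the Newton pair `(h, p)` gives a second Newton pair for `e`; the two logarithmic
derivatives must agree. -/
theorem omega_p {r : ℕ} (hr : r ≠ 0) : omega (p r) = (-1 : ℚ) ^ (r + 1) • p r := by
  obtain ⟨r, rfl⟩ := Nat.exists_eq_succ_of_ne_zero hr
  have h1 := isNewton_h.map omega.toRingHom
  have h2 : (fun n => omega.toRingHom (h n)) = e := funext omega_h
  rw [h2] at h1
  exact h1.log_unique isNewton_e r

theorem smul_prod_map {R : Type*} [CommRing R] [Algebra ℚ R] (s : Multiset ℕ) (c : ℕ → ℚ)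
    (f : ℕ → R) : (s.map fun i => c i • f i).prod = (s.map c).prod • (s.map f).prod := by
  induction s using Multiset.induction_on with
  | empty => simp
  | cons a s ih => simp only [Multiset.map_cons, Multiset.prod_cons, ih, smul_mul_smul_comm]

theorem omega_pP {n : ℕ} (ν : n.Partition) :
    omega (pP ν) = (ν.parts.map fun r => (-1 : ℚ) ^ (r + 1)).prod • pP ν := by
  rw [pP, map_multiset_prod, Multiset.map_map, ← smul_prod_map]
  exact congrArg _ (Multiset.map_congr rfl fun i hi => omega_p (ν.parts_pos hi).ne')

/-- The power sums are algebraically independent, so the `p_ν` are linearly independent. -/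
theorem eq_of_sum_smul_pP_eq {n : ℕ} {a b : n.Partition → ℚ}
    (hab : ∑ ν, a ν • pP ν = ∑ ν, b ν • pP ν) : a = b := by
  classical
  -- The variable `X r` is a model for `p r`, and `E n` is the expression of `e n` in it. The
  -- fundamental theorem gives `ψ` with `ψ (e n) = E n`; then `log_unique` forces `ψ (p r) = X r`,
  -- so distinct `p_ν` go to distinct monomials.
  set Ψ : ℕ → MvPolynomial ℕ ℚ := fun r => (-1 : ℚ) ^ (r + 1) • MvPolynomial.X r with hΨ
  set E : ℕ → MvPolynomial ℕ ℚ :=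
    fun n => ∑ ν : n.Partition, (z ν : ℚ)⁻¹ • (ν.parts.map Ψ).prod with hE
  have hN : IsNewton E Ψ := isNewton_sum_partition Ψ
  let ψ : Sym →ₐ[ℚ] MvPolynomial ℕ ℚ :=
    (MvPolynomial.aeval fun i => E (i + 1)).comp (eEquiv.symm : Sym →ₐ[ℚ] MvPolynomial ℕ ℚ)
  have hψe : ∀ n, ψ (e n) = E n := by
    intro n
    cases n with
    | zero => rw [e_zero, map_one, hN.1]
    | succ n =>
      have h1 : eEquiv (MvPolynomial.X n) = e (n + 1) := by
        change eHom _ = _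
        rw [eHom, MvPolynomial.aeval_X]
      change MvPolynomial.aeval _ (eEquiv.symm (e (n + 1))) = _
      rw [← h1, AlgEquiv.symm_apply_apply, MvPolynomial.aeval_X]
  have hψp : ∀ r, r ≠ 0 → ψ (p r) = MvPolynomial.X r := by
    intro r hr
    obtain ⟨r, rfl⟩ := Nat.exists_eq_succ_of_ne_zero hr
    have h1 := isNewton_e.map ψ.toRingHom
    have h2 : (fun n => ψ.toRingHom (e n)) = E := funext hψe
    rw [h2] at h1
    have h3 : ψ ((-1 : ℚ) ^ (r + 1 + 1) • p (r + 1)) = Ψ (r + 1) := h1.log_unique hN r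
    rw [map_smul] at h3
    exact smul_right_injective _ (pow_ne_zero _ (by norm_num : (-1 : ℚ) ≠ 0)) h3
  have hmon : ∀ s : Multiset ℕ, (s.map (MvPolynomial.X (R := ℚ))).prod =
      MvPolynomial.monomial (Multiset.toFinsupp s) 1 := by
    intro s
    induction s using Multiset.induction_on with
    | empty => simp
    | cons a s ih =>
      rw [Multiset.map_cons, Multiset.prod_cons, ih, MvPolynomial.X, MvPolynomial.monomial_mul,
        one_mul, ← Multiset.singleton_add, map_add, Multiset.toFinsupp_singleton]
  have hψP : ∀ ν : n.Partition, ψ (pP ν) = MvPolynomial.monomial (Multiset.toFinsupp ν.parts) 1 := by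
    intro ν
    rw [pP, map_multiset_prod, Multiset.map_map, ← hmon]
    exact congrArg _ (Multiset.map_congr rfl fun i hi => hψp i (ν.parts_pos hi).ne')
  have hcoef : ∀ (a : n.Partition → ℚ) (ν : n.Partition),
      (ψ (∑ ν, a ν • pP ν)).coeff (Multiset.toFinsupp ν.parts) = a ν := by
    intro a ν
    rw [map_sum, MvPolynomial.coeff_sum, Finset.sum_eq_single ν]
    · rw [map_smul, hψP, MvPolynomial.coeff_smul, MvPolynomial.coeff_monomial, if_pos rfl,
        smul_eq_mul, mul_one]
    · intro ν' _ hne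
      rw [map_smul, hψP, MvPolynomial.coeff_smul, MvPolynomial.coeff_monomial, if_neg, smul_zero]
      exact fun heq => hne (Nat.Partition.ext (Multiset.toFinsupp.injective heq))
    · exact fun hne => absurd (Finset.mem_univ _) hne
  funext ν
  rw [← hcoef a ν, hab, hcoef]

/-! ### Zero-one matrices, and coefficients of products of elementary functions. -/

/-- Exchange of the two indices of a finitely supported matrix. -/
noncomputable def transposeEquiv : (ℕ →₀ ℕ →₀ ℕ) ≃ (ℕ →₀ ℕ →₀ ℕ) :=
  Finsupp.curryEquiv.symm.trans
    ((Finsupp.domCongr (Equiv.prodComm ℕ ℕ)).toEquiv.trans Finsupp.curryEquiv)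

theorem transposeEquiv_apply (l : ℕ →₀ ℕ →₀ ℕ) (i j : ℕ) : transposeEquiv l j i = l i j := by
  simp [transposeEquiv, Finsupp.curryEquiv, Finsupp.curry_apply]

theorem transposeEquiv_transposeEquiv (l : ℕ →₀ ℕ →₀ ℕ) :
    transposeEquiv (transposeEquiv l) = l := by
  ext i j
  rw [transposeEquiv_apply, transposeEquiv_apply]

theorem degree_transposeEquiv (l : ℕ →₀ ℕ →₀ ℕ) (j : ℕ) :
    (transposeEquiv l j).degree = (∑ i ∈ l.support, l i) j := by
  rw [Finsupp.finsetSum_apply, Finsupp.degree_apply]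
  simp only [transposeEquiv_apply]
  refine Finset.sum_subset (fun i hi => ?_) fun i _ hi => ?_
  · rw [Finsupp.mem_support_iff, transposeEquiv_apply] at hi
    rw [Finsupp.mem_support_iff]
    intro h0
    exact hi (by rw [h0]; rfl)
  · rwa [Finsupp.notMem_support_iff, transposeEquiv_apply] at hi

/-- The matrices of zeros and ones with given row and column sums. -/
def binaryMatrices (c d : ℕ →₀ ℕ) : Set (ℕ →₀ ℕ →₀ ℕ) :=
  {l | (∀ i j, l i j ≤ 1) ∧ (∀ i, (l i).degree = c i) ∧ ∀ j, (transposeEquiv l j).degree = d j}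

theorem ncard_binaryMatrices_comm (c d : ℕ →₀ ℕ) :
    (binaryMatrices c d).ncard = (binaryMatrices d c).ncard := by
  refine Set.ncard_congr (fun l _ => transposeEquiv l) ?_ ?_ ?_
  · rintro l ⟨h1, h2, h3⟩
    exact ⟨fun i j => by rw [transposeEquiv_apply]; exact h1 j i, h3,
      fun j => by rw [transposeEquiv_transposeEquiv]; exact h2 j⟩
  · exact fun l l' _ _ hl => transposeEquiv.injective hl
  · rintro l ⟨h1, h2, h3⟩
    exact ⟨transposeEquiv l, ⟨fun i j => by rw [transposeEquiv_apply]; exact h1 j i, h3,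
      fun j => by rw [transposeEquiv_transposeEquiv]; exact h2 j⟩,
      transposeEquiv_transposeEquiv l⟩

/-- Row `i` of a matrix records the squarefree monomial taken from the factor `e (c i)`; the rows
add up to the exponent vector `d`. -/
theorem coeff_prod_e (c d : ℕ →₀ ℕ) :
    coeff d (c.prod fun _ a => e a) = (binaryMatrices c d).ncard := by
  classical
  have h1 : coeff d (c.prod fun _ a => e a) =
      MvPowerSeries.coeff d (∏ i ∈ c.support, toSeries (e (c i))) := by
    change MvPowerSeries.coeff d (toSeries (c.prod fun _ a => e a)) = _
    rw [Finsupp.prod, map_prod]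
  rw [h1, MvPowerSeries.coeff_prod]
  have h2 : ∀ l : ℕ →₀ ℕ →₀ ℕ,
      ∏ i ∈ c.support, MvPowerSeries.coeff (l i) (toSeries (e (c i))) =
        if ∀ i ∈ c.support, (∀ j, l i j ≤ 1) ∧ (l i).degree = c i then (1 : ℚ) else 0 := by
    intro l
    have h3 : ∀ i ∈ c.support, MvPowerSeries.coeff (l i) (toSeries (e (c i))) =
        if (∀ j, l i j ≤ 1) ∧ (l i).degree = c i then (1 : ℚ) else 0 :=
      fun i _ => coeff_e (l i) (c i)
    rw [Finset.prod_congr rfl h3, Finset.prod_ite_zero, Finset.prod_const_one]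
  rw [Finset.sum_congr rfl fun l _ => h2 l, ← Finset.sum_filter, Finset.sum_const, nsmul_eq_mul,
    mul_one, ← Set.ncard_coe_finset]
  congr 2
  ext l
  rw [Finset.mem_coe, Finset.mem_filter, Finset.mem_finsuppAntidiag]
  constructor
  · rintro ⟨⟨hsum, hsupp⟩, hl⟩
    have h0 : ∀ i, i ∉ c.support → l i = 0 := fun i hi =>
      Finsupp.notMem_support_iff.1 fun h => hi (hsupp h)
    refine ⟨fun i j => ?_, fun i => ?_, fun j => ?_⟩
    · by_cases hi : i ∈ c.support
      · exact (hl i hi).1 j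
      · rw [h0 i hi]
        exact Nat.zero_le _
    · by_cases hi : i ∈ c.support
      · exact (hl i hi).2
      · rw [h0 i hi, map_zero, Finsupp.notMem_support_iff.1 hi]
    · rw [degree_transposeEquiv, ← hsum]
      congr 1
      exact Finset.sum_subset hsupp fun i _ hi => Finsupp.notMem_support_iff.1 hi
  · rintro ⟨hle, hc, hd⟩
    have hsupp : l.support ⊆ c.support := by
      intro i hi
      rw [Finsupp.mem_support_iff] at hi ⊢
      rwa [← hc i, Ne, Finsupp.degree_eq_zero_iff]
    refine ⟨⟨?_, hsupp⟩, fun i _ => ⟨hle i, hc i⟩⟩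
    ext j
    rw [← hd j, degree_transposeEquiv]
    congr 1
    exact (Finset.sum_subset hsupp fun i _ hi => Finsupp.notMem_support_iff.1 hi).symm

theorem coeff_prod_e_comm (c d : ℕ →₀ ℕ) :
    coeff d (c.prod fun _ a => e a) = coeff c (d.prod fun _ a => e a) := by
  rw [coeff_prod_e, coeff_prod_e, ncard_binaryMatrices_comm]

theorem prod_expo {R : Type*} [CommSemiring R] (s : Multiset ℕ) (hs : 0 ∉ s) (g : ℕ → R) :
    (expo s).prod (fun _ a => g a) = (s.map g).prod := by
  conv_rhs => rw [← vals_expo s hs, vals, Multiset.map_map]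
  rfl

theorem coeff_rho (k : ℕ) [NeZero k] (f : Sym) (d : ℕ →₀ ℕ) :
    coeff d (rho k f) = coeff (k • d) f := rfl

/-- After the exchange of rows and columns, the column sums `k • d` selected by `rho` become indices
of elementary functions. -/
theorem coeff_rho_eP (k : ℕ) [NeZero k] {N : ℕ} (μ : N.Partition) (d : ℕ →₀ ℕ) :
    coeff d (rho k (eP μ)) = mcoeff μ (d.prod fun _ a => e (k * a)) := by
  rw [coeff_rho, eP, ← prod_expo _ (zero_notMem_parts μ), coeff_prod_e_comm, mcoeff]
  congr 1
  have : (k • d).support = d.support := by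
    ext i; simp [NeZero.ne k]
  rw [Finsupp.prod, Finsupp.prod, this]
  rfl

theorem degree_expo {N : ℕ} (μ : N.Partition) : (expo μ.parts).degree = N := by
  rw [degree_eq_sum_vals, vals_expo _ (zero_notMem_parts μ), μ.parts_sum]

/-- The sum of all entries of a matrix is the same by rows and by columns. -/
theorem coeff_prod_e_eq_zero {c d : ℕ →₀ ℕ} (h : c.degree ≠ d.degree) :
    coeff d (c.prod fun _ a => e a) = 0 := by
  rw [coeff_prod_e, Nat.cast_eq_zero]
  have : binaryMatrices c d = ∅ := by
    rw [Set.eq_empty_iff_forall_notMem]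
    rintro l ⟨-, hc, hd⟩
    apply h
    have h1 : l.support ⊆ c.support := by
      intro i hi
      rw [Finsupp.mem_support_iff] at hi ⊢
      rwa [← hc i, Ne, Finsupp.degree_eq_zero_iff]
    have h2 : ∑ i ∈ l.support, l i = d := by
      ext j
      rw [← hd j, degree_transposeEquiv]
    rw [← h2, map_sum, Finset.sum_subset h1 fun i _ hi => by
      rw [Finsupp.notMem_support_iff.1 hi, map_zero], Finsupp.degree_apply]
    exact Finset.sum_congr rfl fun i _ => (hc i).symm
  rw [this, Set.ncard_empty]

theorem coeff_rho_eP_eq_zero (k : ℕ) [NeZero k] {N : ℕ} (μ : N.Partition) {d : ℕ →₀ ℕ}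
    (hd : k * d.degree ≠ N) : coeff d (rho k (eP μ)) = 0 := by
  rw [coeff_rho, eP, ← prod_expo _ (zero_notMem_parts μ)]
  refine coeff_prod_e_eq_zero ?_
  rw [degree_expo, map_nsmul, smul_eq_mul]
  exact hd.symm

theorem coeff_pP_eq_zero {n : ℕ} (ν : n.Partition) {d : ℕ →₀ ℕ} (hd : d.degree ≠ n) :
    coeff d (pP ν) = 0 := by
  have key : ∀ (s : Multiset ℕ) (d : ℕ →₀ ℕ), 0 ∉ s → d.degree ≠ s.sum →
      coeff d ((s.map p).prod) = 0 := by
    intro s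
    induction s using Multiset.induction_on with
    | empty =>
      intro d _ hd
      rw [Multiset.map_zero, Multiset.prod_zero, coeff_one, if_neg]
      rintro rfl
      exact hd rfl
    | cons a s ih =>
      intro d hs hd
      rw [Multiset.mem_cons, not_or] at hs
      rw [Multiset.sum_cons] at hd
      rw [Multiset.map_cons, Multiset.prod_cons, coeff_p_mul (Ne.symm hs.1)]
      refine Finset.sum_eq_zero fun i hi => ih _ hs.2 ?_
      have := degree_sub_single (Finset.mem_filter.1 hi).2
      omega
  exact key _ _ (zero_notMem_parts ν) (by rwa [ν.parts_sum])

/-! ### The functions `Φ_{k,r}` -/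

theorem coeff_B (k j : ℕ) : PowerSeries.coeff j (B k) = (-1) ^ j * e (k * j) :=
  PowerSeries.coeff_mk _ _

theorem constantCoeff_B (k : ℕ) : PowerSeries.constantCoeff (B k) = 1 := by
  rw [← PowerSeries.coeff_zero_eq_constantCoeff_apply, coeff_B, pow_zero, one_mul, mul_zero, e_zero]

/-- Expand the logarithm at `u = B k - 1`. The signs in `u` multiply to `(-1) ^ r` along every
composition, as its blocks sum to `r`. -/
theorem Phi_eq_fkr (k r : ℕ) : Phi k r = fkr k r := by
  rw [Phi, fkr, PowerSeries.coeff_logOf (constantCoeff_B k), Finset.smul_sum,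
    ← Finset.sum_neg_distrib]
  refine Finset.sum_congr rfl fun j _ => ?_
  have hc : PowerSeries.constantCoeff (B k - 1) = 0 := by
    rw [map_sub, map_one, constantCoeff_B, sub_self]
  rw [PowerSeries.coeff_pow_eq_sum_composition hc, smul_smul, ← neg_smul]
  have h1 : ∀ α : Composition r, (α.blocks.map fun a => PowerSeries.coeff a (B k - 1)).prod =
      (-1 : ℚ) ^ r • (α.blocks.map fun a => e (k * a)).prod := by
    intro α
    have h2 : α.blocks.map (fun a => PowerSeries.coeff a (B k - 1)) =
        α.blocks.map fun a => (-1 : ℚ) ^ a • e (k * a) := by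
      refine List.map_congr_left fun a ha => ?_
      have ha0 : a ≠ 0 := (α.blocks_pos ha).ne'
      rw [map_sub, coeff_B, PowerSeries.coeff_one, if_neg ha0, sub_zero, Algebra.smul_def, map_pow,
        map_neg, map_one]
    have h3 := smul_prod_map (α.blocks : Multiset ℕ) (fun a => (-1 : ℚ) ^ a) fun a => e (k * a)
    rw [Multiset.map_coe, Multiset.map_coe, Multiset.map_coe, Multiset.prod_coe, Multiset.prod_coe,
      Multiset.prod_coe] at h3
    have h4 : (α.blocks.map fun a => (-1 : ℚ) ^ a).prod = (-1) ^ r := by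
      conv_rhs => rw [← α.blocks_sum]
      induction α.blocks with
      | nil => rfl
      | cons a l ih => rw [List.map_cons, List.prod_cons, ih, List.sum_cons, pow_add]
    rw [h2, h3, h4]
  rw [Finset.sum_congr rfl fun α _ => h1 α, ← Finset.smul_sum, smul_smul]
  congr 1
  ring

/-- This is `∑ Φ_{k,r} t^r = -t B'/B` with the denominator cleared. -/
theorem mk_Phi_mul_B (k : ℕ) :
    PowerSeries.mk (Phi k) * B k = -(PowerSeries.X * PowerSeries.derivative Sym (B k)) := by
  have h1 : PowerSeries.mk (Phi k) =
      -(PowerSeries.X * PowerSeries.derivative Sym (PowerSeries.logOf (B k))) := by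
    ext1 r
    rw [PowerSeries.coeff_mk, Phi, map_neg]
    cases r with
    | zero => rw [PowerSeries.coeff_zero_X_mul, Nat.cast_zero, zero_smul]
    | succ r =>
      rw [PowerSeries.coeff_succ_X_mul, PowerSeries.coeff_derivative, Algebra.smul_def, map_natCast,
        mul_comm, Nat.cast_succ]
  rw [h1, ← PowerSeries.mul_derivative_logOf (constantCoeff_B k)]
  ring

/-- Substituting `-t` for `t` in `mk_Phi_mul_B` removes the signs from `B` and places them on the
`Φ`. -/
theorem isNewton_Phi (k : ℕ) :
    IsNewton (fun n => e (k * n)) (fun r => (-1 : ℚ) ^ (r + 1) • Phi k r) := by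
  refine ⟨(congrArg e (mul_zero k)).trans e_zero, fun n => ?_⟩
  have h1 := congrArg (PowerSeries.coeff (n + 1)) (mk_Phi_mul_B k)
  have h0 : Phi k 0 = 0 := by rw [Phi, Nat.cast_zero, zero_smul, neg_zero]
  rw [map_neg, PowerSeries.coeff_succ_X_mul, PowerSeries.coeff_derivative, PowerSeries.coeff_mul,
    Finset.Nat.sum_antidiagonal_succ, PowerSeries.coeff_mk, h0, zero_mul, zero_add, coeff_B] at h1
  have h2 : ((n : Sym) + 1) * e (k * (n + 1)) = (-1) ^ n *
      ∑ q ∈ Finset.HasAntidiagonal.antidiagonal n, PowerSeries.coeff (q.1 + 1) (PowerSeries.mk (Phi k)) *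
        PowerSeries.coeff q.2 (B k) := by
    rw [h1, pow_succ]
    have hs : (-1 : Sym) ^ n * (-1 : Sym) ^ n = 1 := by
      rw [← mul_pow, neg_one_mul, neg_neg, one_pow]
    linear_combination (-(e (k * (n + 1)) * ((n : Sym) + 1))) * hs
  simp only
  rw [h2, Finset.mul_sum]
  refine Finset.sum_congr rfl fun q hq => ?_
  rw [PowerSeries.coeff_mk, coeff_B, ← Finset.HasAntidiagonal.mem_antidiagonal.1 hq,
    Algebra.smul_def, map_pow, map_neg, map_one, pow_add, pow_succ, pow_succ]
  have hs : (-1 : Sym) ^ q.2 * (-1 : Sym) ^ q.2 = 1 := by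
    rw [← mul_pow, neg_one_mul, neg_neg, one_pow]
  linear_combination ((-1 : Sym) ^ q.1 * Phi k (q.1 + 1) * e (k * q.2)) * hs

/-- In degree `n`, apply `[m_μ]` to the power sum expansion of `∏ e_{k d_i}`. In other degrees both
sides vanish by homogeneity. -/
theorem rho_eP_eq_sum (k : ℕ) [NeZero k] {n : ℕ} (μ : (n * k).Partition) :
    rho k (eP μ) = ∑ ν : n.Partition,
      (mcoeff μ (ν.parts.map fun r => (-1 : ℚ) ^ (r + 1) • Phi k r).prod / (z ν : ℚ)) • pP ν := by
  ext d
  rw [map_sum]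
  by_cases hd : d.degree = n
  · rw [coeff_rho_eP, prod_eq_sum_coeff_pP (isNewton_Phi k) n d hd, mcoeff, map_sum]
    refine Finset.sum_congr rfl fun ν _ => ?_
    rw [map_smul, map_smul, map_smul, mcoeff, smul_eq_mul, smul_eq_mul, smul_eq_mul]
    ring
  · rw [coeff_rho_eP_eq_zero, Finset.sum_eq_zero]
    · intro ν _
      rw [map_smul, coeff_pP_eq_zero ν hd, smul_zero]
    · rw [mul_comm]
      exact fun h => hd (Nat.eq_of_mul_eq_mul_right (NeZero.pos k) h)

theorem omega_rho_eP_eq_sum (k : ℕ) [NeZero k] {n : ℕ} (μ : (n * k).Partition) :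
    omega (rho k (eP μ)) =
      ∑ ν : n.Partition, (mcoeff μ (ν.parts.map (Phi k)).prod / (z ν : ℚ)) • pP ν := by
  rw [rho_eP_eq_sum, map_sum]
  refine Finset.sum_congr rfl fun ν _ => ?_
  have h1 : ∀ s : Multiset ℕ, (s.map fun r => (-1 : ℚ) ^ (r + 1)).prod *
      (s.map fun r => (-1 : ℚ) ^ (r + 1)).prod = 1 := by
    intro s
    rw [← Multiset.prod_map_mul]
    refine Multiset.prod_eq_one fun x hx => ?_
    obtain ⟨r, -, rfl⟩ := Multiset.mem_map.1 hx
    rw [← mul_pow, neg_one_mul, neg_neg, one_pow]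
  rw [map_smul, omega_pP, smul_prod_map, mcoeff, map_smul, smul_smul, smul_eq_mul, ← mcoeff]
  congr 1
  linear_combination (mcoeff μ (ν.parts.map (Phi k)).prod / (z ν : ℚ)) * h1 ν.parts

/-! ### Transfer matrices and the nonnegativity of `Φ`. -/

section TransferMatrix

variable {R : Type*} {N : ℕ}

/-- The matrix with entries `y_j` above the diagonal. -/
def ascentMatrix [CommSemiring R] (y : Fin N → R) : Matrix (Fin N) (Fin N) R :=
  Matrix.of fun i j => if i < j then y j else 0

/-- The matrix with entries `y_j` on and below the diagonal. -/
def descentMatrix [CommSemiring R] (y : Fin N → R) : Matrix (Fin N) (Fin N) R :=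
  Matrix.of fun i j => if i < j then 0 else y j

/-- Each factor strictly raises the index, so `n` steps raise it by at least `n`. -/
theorem ascentMatrix_pow_apply_eq_zero [CommSemiring R] (y : Fin N → R) (n : ℕ) :
    ∀ i j : Fin N, (j : ℕ) < i + n → (ascentMatrix y ^ n) i j = 0 := by
  induction n with
  | zero =>
    intro i j hij
    rw [pow_zero, Matrix.one_apply_ne]
    rintro rfl
    omega
  | succ n ih =>
    intro i j hij
    rw [pow_succ', Matrix.mul_apply]
    refine Finset.sum_eq_zero fun l _ => ?_
    rw [ascentMatrix, Matrix.of_apply]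
    split_ifs with hl
    · rw [← ascentMatrix, ih, mul_zero]
      have : (i : ℕ) < l := hl
      omega
    · rw [zero_mul]

theorem trace_ascentMatrix_pow [CommSemiring R] (y : Fin N → R) {n : ℕ} (hn : n ≠ 0) :
    (ascentMatrix y ^ n).trace = 0 :=
  Finset.sum_eq_zero fun i _ => ascentMatrix_pow_apply_eq_zero y n i i (by omega)

/-- Split off the least element `j` of each subset. -/
theorem sum_powersetCard_succ [CommSemiring R] (y : Fin N → R) (n : ℕ) (s : Finset (Fin N)) :
    ∑ A ∈ s.powersetCard (n + 1), ∏ a ∈ A, y a =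
      ∑ j ∈ s, y j * ∑ A ∈ (s.filter (j < ·)).powersetCard n, ∏ a ∈ A, y a := by
  induction s using Finset.induction_on_min with
  | empty => rw [Finset.powersetCard_eq_empty.2 (Nat.succ_pos n), Finset.sum_empty, Finset.sum_empty]
  | insert a s ha ih =>
    have hna : a ∉ s := fun h => lt_irrefl _ (ha a h)
    rw [Finset.powersetCard_succ_insert hna, Finset.sum_union, Finset.sum_image,
      Finset.sum_insert hna, ih, add_comm]
    · congr 1
      · have h1 : (insert a s).filter (a < ·) = s := by
          rw [Finset.filter_insert, if_neg (lt_irrefl a), Finset.filter_true_of_mem ha]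
        rw [h1, Finset.mul_sum]
        refine Finset.sum_congr rfl fun A hA => ?_
        rw [Finset.prod_insert fun h => hna ((Finset.mem_powersetCard.1 hA).1 h)]
      · refine Finset.sum_congr rfl fun j hj => ?_
        rw [Finset.filter_insert, if_neg (ha j hj).le.not_gt]
    · intro A hA A' hA' hAA
      have hA1 : a ∉ A := fun h => hna ((Finset.mem_powersetCard.1 hA).1 h)
      have hA2 : a ∉ A' := fun h => hna ((Finset.mem_powersetCard.1 hA').1 h)
      rw [← Finset.erase_insert hA1, hAA, Finset.erase_insert hA2]
    · rw [Finset.disjoint_left]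
      intro A hA hA'
      obtain ⟨A', -, rfl⟩ := Finset.mem_image.1 hA'
      exact hna ((Finset.mem_powersetCard.1 hA).1 (Finset.mem_insert_self _ _))

/-- A path of `n` steps starting at `i` is an increasing sequence above `i`, that is, an `n`-subset
of `Ioi i`. -/
theorem ascentMatrix_pow_mulVec_one [CommSemiring R] (y : Fin N → R) (n : ℕ) (i : Fin N) :
    ((ascentMatrix y ^ n).mulVec 1) i = ∑ A ∈ (Finset.Ioi i).powersetCard n, ∏ a ∈ A, y a := by
  induction n generalizing i with
  | zero => simp
  | succ n ih =>
    rw [pow_succ', ← Matrix.mulVec_mulVec, sum_powersetCard_succ, Matrix.mulVec, dotProduct,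
      ← Finset.sum_subset (Finset.subset_univ (Finset.Ioi i))]
    · refine Finset.sum_congr rfl fun j hj => ?_
      have hij : i < j := Finset.mem_Ioi.1 hj
      have h1 : (Finset.Ioi i).filter (j < ·) = Finset.Ioi j := by
        ext l
        simp only [Finset.mem_filter, Finset.mem_Ioi]
        exact ⟨fun h => h.2, fun h => ⟨hij.trans h, h⟩⟩
      rw [ih, h1, ascentMatrix, Matrix.of_apply, if_pos hij]
    · intro j _ hj
      rw [Finset.mem_Ioi] at hj
      rw [ascentMatrix, Matrix.of_apply, if_neg hj, zero_mul]

theorem dotProduct_ascentMatrix_pow [CommSemiring R] (y : Fin N → R) (n : ℕ) :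
    y ⬝ᵥ (ascentMatrix y ^ n).mulVec 1 =
      ∑ A ∈ Finset.univ.powersetCard (n + 1), ∏ a ∈ A, y a := by
  rw [sum_powersetCard_succ, dotProduct]
  refine Finset.sum_congr rfl fun j _ => ?_
  rw [ascentMatrix_pow_mulVec_one]
  congr 3
  ext l
  simp

/-- The ascent and descent matrices add up to `1 yᵀ`. This puts the transfer matrix in the form
required by `traceSeries_mul_eq`, with the nilpotent `S = A ^ (k + 1)`. -/
theorem vecMulVec_sub_ascentMatrix_pow [CommRing R] (y : Fin N → R) (k : ℕ) :
    Matrix.vecMulVec ((ascentMatrix y ^ k).mulVec 1) y - ascentMatrix y ^ (k + 1) =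
      ascentMatrix y ^ k * descentMatrix y := by
  have h1 : descentMatrix y = Matrix.vecMulVec 1 y - ascentMatrix y := by
    ext i j
    rw [Matrix.sub_apply, Matrix.vecMulVec_apply, descentMatrix, ascentMatrix, Matrix.of_apply,
      Matrix.of_apply, Pi.one_apply, one_mul]
    split_ifs
    · rw [sub_self]
    · rw [sub_zero]
  rw [h1, mul_sub, pow_succ, Matrix.mul_vecMulVec]

end TransferMatrix

theorem restr_e_eq_sum (N n : ℕ) :
    restr N (e n) = ∑ A ∈ (Finset.univ : Finset (Fin N)).powersetCard n,
      ∏ a ∈ A, (MvPowerSeries.X a : MvPowerSeries (Fin N) ℚ) := by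
  rw [restr_e, MvPolynomial.esymm, ← MvPolynomial.coeToMvPowerSeries.ringHom_apply, map_sum]
  refine Finset.sum_congr rfl fun A _ => ?_
  rw [map_prod]
  refine Finset.prod_congr rfl fun a _ => ?_
  rw [MvPolynomial.coeToMvPowerSeries.ringHom_apply, MvPolynomial.coe_X]

/-- In finitely many variables, `Φ_{k,r}` is the trace of the `r`-th power of a transfer matrix:
it enumerates the cyclic words of length `k r` with descents exactly at the multiples of `k`. -/
theorem restr_Phi_eq_trace (N k : ℕ) {r : ℕ} (hr : r ≠ 0) :
    restr N (Phi (k + 1) r) =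
      ((ascentMatrix (MvPowerSeries.X (R := ℚ)) ^ k *
        descentMatrix (MvPowerSeries.X : Fin N → MvPowerSeries (Fin N) ℚ)) ^ r).trace := by
  set y : Fin N → MvPowerSeries (Fin N) ℚ := MvPowerSeries.X with hy
  set φ : Sym →+* MvPowerSeries (Fin N) ℚ := (restr N).toRingHom with hφ
  have hcoeff : ∀ n, PowerSeries.coeff n (PowerSeries.map φ (B (k + 1))) =
      (-1) ^ n * restr N (e ((k + 1) * n)) := by
    intro n
    rw [PowerSeries.coeff_map, coeff_B, map_mul, map_pow, map_neg, map_one]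
    rfl
  have hB0 : PowerSeries.constantCoeff (PowerSeries.map φ (B (k + 1))) = 1 := by
    rw [← PowerSeries.coeff_zero_eq_constantCoeff_apply, hcoeff, mul_zero, e_zero, map_one,
      pow_zero, one_mul]
  -- With these `S`, `v`, `w` the number `wᵀ S ^ n v` is `yᵀ A ^ ((k + 1) * n + k) 1`, the
  -- elementary function of degree `(k + 1) * (n + 1)`.
  have h1 := Matrix.traceSeries_mul_eq (ascentMatrix y ^ (k + 1)) ((ascentMatrix y ^ k).mulVec 1) y
    (fun n hn => by rw [← pow_mul]; exact trace_ascentMatrix_pow y (by positivity))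
    (PowerSeries.map φ (B (k + 1))) hB0 (fun n => by
      rw [hcoeff, Matrix.mulVec_mulVec, ← pow_mul, ← pow_add, dotProduct_ascentMatrix_pow,
        restr_e_eq_sum]
      congr 3)
  have h2 : PowerSeries.map φ (PowerSeries.mk (Phi (k + 1))) * PowerSeries.map φ (B (k + 1)) =
      -(PowerSeries.X * PowerSeries.derivative _ (PowerSeries.map φ (B (k + 1)))) := by
    rw [← map_mul, mk_Phi_mul_B, map_neg, map_mul, PowerSeries.map_X]
    congr 2
    ext1 n
    rw [PowerSeries.coeff_map, PowerSeries.coeff_derivative, PowerSeries.coeff_derivative,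
      PowerSeries.coeff_map, map_mul, map_add, map_natCast, map_one]
  have hne : PowerSeries.map φ (B (k + 1)) ≠ 0 := by
    intro h0
    rw [h0, map_zero] at hB0
    exact zero_ne_one hB0
  -- The series of the `Φ` and of the traces solve the same equation `F * B = -X B'`, and `B` is a
  -- nonzero element of a domain.
  have h3 := congrArg (PowerSeries.coeff r) (mul_right_cancel₀ hne (h2.trans h1.symm))
  rw [PowerSeries.coeff_map, PowerSeries.coeff_mk, PowerSeries.coeff_mk, if_neg hr,
    vecMulVec_sub_ascentMatrix_pow] at h3
  exact h3

/-- The entries of the transfer matrices are sums of monomials, so the trace can already be formed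
over `ℕ`; the definitions over semirings serve this purpose. -/
theorem exists_restr_Phi_eq_map (N k : ℕ) [NeZero k] {r : ℕ} (hr : r ≠ 0) :
    ∃ F : MvPowerSeries (Fin N) ℕ,
      restr N (Phi k r) = MvPowerSeries.map (Nat.castRingHom ℚ) F := by
  obtain ⟨k, rfl⟩ := Nat.exists_eq_succ_of_ne_zero (NeZero.ne k)
  let φ : MvPowerSeries (Fin N) ℕ →+* MvPowerSeries (Fin N) ℚ :=
    MvPowerSeries.map (Nat.castRingHom ℚ)
  have hX : ∀ i, φ (MvPowerSeries.X i) = MvPowerSeries.X i := fun i => MvPowerSeries.map_X _ i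
  have h1 : φ.mapMatrix (ascentMatrix (MvPowerSeries.X : Fin N → MvPowerSeries (Fin N) ℕ)) =
      ascentMatrix MvPowerSeries.X := by
    ext1 i j
    rw [RingHom.mapMatrix_apply, Matrix.map_apply, ascentMatrix, ascentMatrix, Matrix.of_apply,
      Matrix.of_apply, apply_ite φ, hX, map_zero]
  have h2 : φ.mapMatrix (descentMatrix (MvPowerSeries.X : Fin N → MvPowerSeries (Fin N) ℕ)) =
      descentMatrix MvPowerSeries.X := by
    ext1 i j
    rw [RingHom.mapMatrix_apply, Matrix.map_apply, descentMatrix, descentMatrix, Matrix.of_apply,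
      Matrix.of_apply, apply_ite φ, hX, map_zero]
  refine ⟨((ascentMatrix (MvPowerSeries.X (R := ℕ)) ^ k *
    descentMatrix (MvPowerSeries.X : Fin N → MvPowerSeries (Fin N) ℕ)) ^ r).trace, ?_⟩
  rw [restr_Phi_eq_trace N k hr, ← h1, ← h2, ← map_pow, ← map_mul, ← map_pow]
  exact (AddMonoidHom.map_trace φ.toAddMonoidHom _).symm

theorem exists_embDomain_eq (d : ℕ →₀ ℕ) :
    ∃ (N : ℕ) (x : Fin N →₀ ℕ), x.embDomain Fin.valEmbedding = d := by
  refine ⟨d.support.sup id + 1, ?_⟩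
  rw [← Set.mem_range, Finsupp.mem_range_embDomain_iff]
  intro i hi
  exact ⟨⟨i, Nat.lt_succ_of_le (Finset.le_sup (f := id) hi)⟩, rfl⟩

/-- The exponent vector of `μ` involves finitely many variables, so its coefficient survives
restriction to those, where every factor has natural coefficients. -/
theorem exists_mcoeff_prod_Phi_eq (k : ℕ) [NeZero k] {N n : ℕ} (μ : N.Partition)
    (ν : n.Partition) : ∃ c : ℕ, mcoeff μ (ν.parts.map (Phi k)).prod = (c : ℚ) := by
  obtain ⟨M, x, hx⟩ := exists_embDomain_eq (expo μ.parts)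
  have key : ∀ s : Multiset ℕ, 0 ∉ s → ∃ F : MvPowerSeries (Fin M) ℕ,
      restr M (s.map (Phi k)).prod = MvPowerSeries.map (Nat.castRingHom ℚ) F := by
    intro s
    induction s using Multiset.induction_on with
    | empty => exact fun _ => ⟨1, by simp⟩
    | cons a s ih =>
      intro hs
      rw [Multiset.mem_cons, not_or] at hs
      obtain ⟨F, hF⟩ := ih hs.2
      obtain ⟨G, hG⟩ := exists_restr_Phi_eq_map M k (Ne.symm hs.1)
      exact ⟨G * F, by rw [Multiset.map_cons, Multiset.prod_cons, map_mul, hF, hG, map_mul]⟩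
  obtain ⟨F, hF⟩ := key _ (zero_notMem_parts ν)
  refine ⟨MvPowerSeries.coeff x F, ?_⟩
  rw [mcoeff, ← hx, ← coeff_restr, hF, MvPowerSeries.coeff_map]
  rfl

theorem isPPositive_omega_rho_eP (k : ℕ) [NeZero k] {N : ℕ} (μ : N.Partition) :
    IsPPositive (omega (rho k (eP μ))) := by
  classical
  by_cases hk : k ∣ N
  · obtain ⟨n, rfl⟩ := exists_eq_mul_left_of_dvd hk
    choose c hc using fun ν : n.Partition => exists_mcoeff_prod_Phi_eq k μ ν
    refine ⟨∑ ν : n.Partition, Finsupp.single ⟨n, ν⟩ (c ν), ?_⟩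
    rw [omega_rho_eP_eq_sum, ← Finsupp.sum_finsetSum_index]
    · refine Finset.sum_congr rfl fun ν _ => ?_
      rw [Finsupp.sum_single_index, hc]
      rw [Nat.cast_zero, zero_div, zero_smul]
    · intro ν
      rw [Nat.cast_zero, zero_div, zero_smul]
    · intro ν a b
      rw [Nat.cast_add, add_div, add_smul]
  -- If `k` does not divide `N`, no monomial of degree `N` has all exponents divisible by `k`.
  · have h0 : rho k (eP μ) = 0 := by
      ext d
      rw [coeff_rho_eP_eq_zero k μ fun h => hk ⟨_, h.symm⟩, map_zero]
    exact ⟨0, by rw [h0, map_zero, Finsupp.sum_zero_index]⟩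

end SymFn

theorem mainTheorem7 (k : ℕ) [NeZero k] :
    (∀ r : ℕ, 1 ≤ r → SymFn.Phi k r = SymFn.fkr k r) ∧
    (∀ (N : ℕ) (μ : N.Partition), SymFn.IsPPositive (SymFn.omega (SymFn.rho k (SymFn.eP μ)))) ∧
    (∀ (n : ℕ) (μ : (n * k).Partition),
      (∀ a : n.Partition → ℚ,
        SymFn.omega (SymFn.rho k (SymFn.eP μ)) =
            ∑ ν : n.Partition, (a ν / (SymFn.z ν : ℚ)) • SymFn.pP ν ↔
          ∀ ν : n.Partition, a ν = SymFn.mcoeff μ (ν.parts.map (SymFn.Phi k)).prod) ∧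
      ∀ ν : n.Partition, ∃ c : ℕ, SymFn.mcoeff μ (ν.parts.map (SymFn.Phi k)).prod = (c : ℚ)) := by
  refine ⟨fun r _ => SymFn.Phi_eq_fkr k r, fun N μ => SymFn.isPPositive_omega_rho_eP k μ,
    fun n μ => ⟨fun a => ⟨fun ha ν => ?_, fun ha => ?_⟩,
      SymFn.exists_mcoeff_prod_Phi_eq k μ⟩⟩
  · rw [SymFn.omega_rho_eP_eq_sum] at ha
    have h1 := congrFun (SymFn.eq_of_sum_smul_pP_eq ha) ν
    exact ((div_left_inj' (Nat.cast_ne_zero.2 (SymFn.z_ne_zero ν))).1 h1).symm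
  · rw [SymFn.omega_rho_eP_eq_sum]
    exact Finset.sum_congr rfl fun ν _ => by rw [ha ν]
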